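/- Let $N\ge 2$ be an integer and let $\kappa>-\frac1N$ be real. For a real polynomial $f$ in $x=(x_1,\dots,x_N)$ and $1\le i\le N$ let $$T_if(x)=\frac{\partial f}{\partial x_i}(x)+\kappa\sum_{j\ne i}\frac{f(x)-f(x(i,j))}{x_i-x_j},\qquad \Delta_\kappa f=\sum_{i=1}^N T_i^2f,$$ where $x(i,j)$ is $x$ with the entries $x_i$ and $x_j$ interchanged. Call $f$ harmonic if $\Delta_\kappa f=0$, planar if $T_jf=0$ for all $2<j\le N$, symmetric if $f(x(1,2))=f(x)$, and antisymmetric if $f(x(1,2))=-f(x)$. Define polynomials $p_n(x_i;x)$ by $\sum_{n\ge0}p_n(x_i;x)r^n=(1-rx_i)^{-1}\prod_{j=1}^N(1-rx_j)^{-\kappa}$. In commuting indeterminates $p_1,p_2,s,t$, expand the formal power series $$\frac{1-st(p_1+p_2)+t^2p_1p_2}{(1-2stp_1+t^2p_1^2)(1-2stp_2+t^2p_2^2)}=\sum_{n\ge0}t^n\sum_{j=0}^n s^j\phi_{nj},$$ $$\frac{t(p_1-p_2)}{(1-2stp_1+t^2p_1^2)(1-2stp_2+t^2p_2^2)}=\sum_{n\ge1}t^n\sum_{j=0}^n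 s^j\psi_{nj},$$ and regard $\phi_{nj},\psi_{nj}$ as polynomials in $x$ by replacing, linearly, each monomial $p_1^ap_2^b$ by $p_a(x_1;x)\,p_b(x_2;x)$. Let $g^o_n,g^e_n$ be the polynomials with $g^o_0=g^e_0=1$ and, for $n\ge0$, $$g^o_{n+1}(v)=(v+3n+1)g^o_n(v)-n(2n-1)g^o_{n-1}(v),\qquad g^e_{n+1}(v)=(v+3n+2)g^e_n(v)-n(2n+1)g^e_{n-1}(v),$$ and let $(a)_j=a(a+1)\cdots(a+j-1)$. For $m\ge0$ put $$h^-_{2m+1}=\sum_{j=0}^m2^{-j}\frac{g^o_j(N\kappa-\kappa+m)}{(N\kappa+m+2)_j}\psi_{2m+1,2j},\qquad h^-_{2m}=\sum_{j=0}^{m-1}2^{-j}\frac{g^e_j(N\kappa-\kappa+m)}{(N\kappa+m+2)_j}\psi_{2m,2j+1},$$ $$h^+_{2m+1}=\sum_{j=0}^m2^{-j}\frac{g^e_j(N\kappa-\kappa+m+1)}{(N\kappa+m+2)_j}\phi_{2m+1,2j+1},\qquad h^+_{2m}=\sum_{j=0}^{m}2^{-j}\frac{g^o_j(N\kappa-\kappa+m)}{(N\kappa+m+1)_j}\phi_{2m,2j}$$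 (so $h^-_0=0$). Then for every $n\ge0$ the polynomials $h_n^+$ and $h_n^-$ are harmonic, $h_n^+$ is symmetric and $h_n^-$ is antisymmetric. Moreover, the space of planar harmonic polynomials that are homogeneous of degree $n$ is exactly the linear span of $h_n^+$ and $h_n^-$, and for $n\ge1$ these two polynomials are linearly independent. -/

import Mathlib

noncomputable section

namespace PlanarHarmonic

open MvPolynomial

/-- `f(x) - f(x(i,j))` is divisible by `x_i - x_j`. -/
theorem X_sub_X_dvd_sub_swap {N : ℕ} (i j : Fin N) (f : MvPolynomial (Fin N) ℝ) :
    (X i - X j : MvPolynomial (Fin N) ℝ) ∣ f - rename (Equiv.swap i j) f := by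
  have key : ∀ k : Fin N, (X i - X j : MvPolynomial (Fin N) ℝ) ∣
      X k - X (Equiv.swap i j k) := by
    intro k
    by_cases h1 : k = i
    · subst h1; simp
    · by_cases h2 : k = j
      · subst h2
        rw [Equiv.swap_apply_right]
        exact ⟨-1, by ring⟩
      · rw [Equiv.swap_apply_of_ne_of_ne h1 h2]; simp
  induction f using MvPolynomial.induction_on with
  | C a => simp
  | add p q hp hq =>
    rw [map_add, add_sub_add_comm]
    exact dvd_add hp hq
  | mul_X p k hp =>
    have h : p * X k - rename (Equiv.swap i j) (p * X k) =
        (p - rename (Equiv.swap i j) p) * X k +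
          rename (Equiv.swap i j) p * (X k - X (Equiv.swap i j k)) := by
      rw [map_mul, rename_X]; ring
    rw [h]
    exact dvd_add (Dvd.dvd.mul_right hp _) (Dvd.dvd.mul_left (key k) _)

/-- The polynomial `(f(x) - f(x(i,j))) / (x_i - x_j)`. It is the unique polynomial quotient
when `i ≠ j`; the case `i = j` is never used. -/
def divDiff {N : ℕ} (i j : Fin N) (f : MvPolynomial (Fin N) ℝ) : MvPolynomial (Fin N) ℝ :=
  Classical.choose (X_sub_X_dvd_sub_swap i j f)

/-- The defining property of the divided difference. -/
theorem divDiff_spec {N : ℕ} (i j : Fin N) (f : MvPolynomial (Fin N) ℝ) :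
    f - rename (Equiv.swap i j) f = (X i - X j) * divDiff i j f :=
  Classical.choose_spec (X_sub_X_dvd_sub_swap i j f)

/-- The type `A` Dunkl operator `T_i` with parameter `κ`. -/
def dunkl {N : ℕ} (κ : ℝ) (i : Fin N) (f : MvPolynomial (Fin N) ℝ) : MvPolynomial (Fin N) ℝ :=
  pderiv i f + C κ * ∑ j ∈ Finset.univ.erase i, divDiff i j f

/-- The Dunkl Laplacian `Δ_κ = ∑ T_i ^ 2`. -/
def dunklLaplacian {N : ℕ} (κ : ℝ) (f : MvPolynomial (Fin N) ℝ) : MvPolynomial (Fin N) ℝ :=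
  ∑ i, dunkl κ i (dunkl κ i f)

/-- The Pochhammer symbol `(a)_k = a (a + 1) ⋯ (a + k - 1)`. -/
def poch (a : ℝ) (k : ℕ) : ℝ := (ascPochhammer ℝ k).eval a

/-- The power series `(1 - r y) ^ (-a) = ∑ (a)_k / k! y ^ k r ^ k` in the variable `r`. -/
def oneSubPowNeg {N : ℕ} (a : ℝ) (y : MvPolynomial (Fin N) ℝ) :
    PowerSeries (MvPolynomial (Fin N) ℝ) :=
  PowerSeries.mk fun k => C (poch a k / (k.factorial : ℝ)) * y ^ k

/-- The polynomial `p_n(x_i; x)`: the coefficient of `r ^ n` in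
`(1 - r x_i)⁻¹ ∏_j (1 - r x_j) ^ (-κ)`. -/
def pPoly {N : ℕ} (κ : ℝ) (i : Fin N) (n : ℕ) : MvPolynomial (Fin N) ℝ :=
  PowerSeries.coeff n (oneSubPowNeg 1 (X i) * ∏ j, oneSubPowNeg κ (X j))

/-- The first coordinate index. -/
def fst {N : ℕ} (hN : 2 ≤ N) : Fin N := ⟨0, by omega⟩

/-- The second coordinate index. -/
def snd {N : ℕ} (hN : 2 ≤ N) : Fin N := ⟨1, by omega⟩

/-- The linear map taking a symbol `p_1 ^ a * p_2 ^ b` to `p_a(x_1; x) p_b(x_2; x)`. -/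
def fromSymbol {N : ℕ} (hN : 2 ≤ N) (κ : ℝ) :
    MvPolynomial (Fin 2) ℝ →ₗ[ℝ] MvPolynomial (Fin N) ℝ :=
  (basisMonomials (Fin 2) ℝ).constr ℝ fun α => pPoly κ (fst hN) (α 0) * pPoly κ (snd hN) (α 1)

/-- Power series in `t` whose coefficients are polynomials in `s` over `ℝ[p_1, p_2]`. -/
abbrev GenSeries : Type := PowerSeries (Polynomial (MvPolynomial (Fin 2) ℝ))

/-- The variable `t`. -/
def tVar : GenSeries := PowerSeries.X

/-- The variable `s`. -/
def sVar : GenSeries := PowerSeries.C Polynomial.X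

/-- The symbols `p_1` (index `0`) and `p_2` (index `1`). -/
def pVar (a : Fin 2) : GenSeries := PowerSeries.C (Polynomial.C (X a))

/-- `((1 - 2 s t p_1 + t² p_1²) (1 - 2 s t p_2 + t² p_2²))⁻¹`; the constant coefficient of the
series to be inverted is `1`. -/
def uDenInv : GenSeries :=
  PowerSeries.invOfUnit
    ((1 - 2 * sVar * tVar * pVar 0 + tVar ^ 2 * pVar 0 ^ 2) *
      (1 - 2 * sVar * tVar * pVar 1 + tVar ^ 2 * pVar 1 ^ 2)) 1

/-- The generating function `u_1` of the `φ_{nj}`. -/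
def u₁ : GenSeries :=
  (1 - sVar * tVar * (pVar 0 + pVar 1) + tVar ^ 2 * pVar 0 * pVar 1) * uDenInv

/-- The generating function `u_2` of the `ψ_{nj}`. -/
def u₂ : GenSeries := tVar * (pVar 0 - pVar 1) * uDenInv

/-- The polynomial `φ_{nj}`: the coefficient of `t ^ n s ^ j` in `u_1`. -/
def phi {N : ℕ} (hN : 2 ≤ N) (κ : ℝ) (n j : ℕ) : MvPolynomial (Fin N) ℝ :=
  fromSymbol hN κ ((PowerSeries.coeff n u₁).coeff j)

/-- The polynomial `ψ_{nj}`: the coefficient of `t ^ n s ^ j` in `u_2`. -/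
def psi {N : ℕ} (hN : 2 ≤ N) (κ : ℝ) (n j : ℕ) : MvPolynomial (Fin N) ℝ :=
  fromSymbol hN κ ((PowerSeries.coeff n u₂).coeff j)

/-- The monic polynomials `g_n^o`:
`g_{n+1} = (v + 3 n + 1) g_n - n (2 n - 1) g_{n-1}`, `g_0 = 1`. -/
def gOdd : ℕ → Polynomial ℝ
  | 0 => 1
  | 1 => Polynomial.X + 1
  | n + 2 =>
    (Polynomial.X + Polynomial.C (3 * ((n : ℝ) + 1) + 1)) * gOdd (n + 1) -
      Polynomial.C (((n : ℝ) + 1) * (2 * ((n : ℝ) + 1) - 1)) * gOdd n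

/-- The monic polynomials `g_n^e`:
`g_{n+1} = (v + 3 n + 2) g_n - n (2 n + 1) g_{n-1}`, `g_0 = 1`. -/
def gEven : ℕ → Polynomial ℝ
  | 0 => 1
  | 1 => Polynomial.X + 2
  | n + 2 =>
    (Polynomial.X + Polynomial.C (3 * ((n : ℝ) + 1) + 2)) * gEven (n + 1) -
      Polynomial.C (((n : ℝ) + 1) * (2 * ((n : ℝ) + 1) + 1)) * gEven n

/-- `h_{2m+1}^-` -/
def hMinusOdd {N : ℕ} (hN : 2 ≤ N) (κ : ℝ) (m : ℕ) : MvPolynomial (Fin N) ℝ :=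
  ∑ j ∈ Finset.range (m + 1),
    ((1 / 2 ^ j) * ((gOdd j).eval (N * κ - κ + m) / poch (N * κ + m + 2) j)) •
      psi hN κ (2 * m + 1) (2 * j)

/-- `h_{2m}^-` -/
def hMinusEven {N : ℕ} (hN : 2 ≤ N) (κ : ℝ) (m : ℕ) : MvPolynomial (Fin N) ℝ :=
  ∑ j ∈ Finset.range m,
    ((1 / 2 ^ j) * ((gEven j).eval (N * κ - κ + m) / poch (N * κ + m + 2) j)) •
      psi hN κ (2 * m) (2 * j + 1)

/-- `h_{2m+1}^+` -/
def hPlusOdd {N : ℕ} (hN : 2 ≤ N) (κ : ℝ) (m : ℕ) : MvPolynomial (Fin N) ℝ :=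
  ∑ j ∈ Finset.range (m + 1),
    ((1 / 2 ^ j) * ((gEven j).eval (N * κ - κ + m + 1) / poch (N * κ + m + 2) j)) •
      phi hN κ (2 * m + 1) (2 * j + 1)

/-- `h_{2m}^+` -/
def hPlusEven {N : ℕ} (hN : 2 ≤ N) (κ : ℝ) (m : ℕ) : MvPolynomial (Fin N) ℝ :=
  ∑ j ∈ Finset.range (m + 1),
    ((1 / 2 ^ j) * ((gOdd j).eval (N * κ - κ + m) / poch (N * κ + m + 1) j)) •
      phi hN κ (2 * m) (2 * j)

/-- `h_n^+` -/
def hPlus {N : ℕ} (hN : 2 ≤ N) (κ : ℝ) (n : ℕ) : MvPolynomial (Fin N) ℝ :=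
  if Even n then hPlusEven hN κ (n / 2) else hPlusOdd hN κ (n / 2)

/-- `h_n^-` -/
def hMinus {N : ℕ} (hN : 2 ≤ N) (κ : ℝ) (n : ℕ) : MvPolynomial (Fin N) ℝ :=
  if Even n then hMinusEven hN κ (n / 2) else hMinusOdd hN κ (n / 2)

/-- Planar polynomials: those annihilated by `T_j` for `2 < j ≤ N`
(indices `2, …, N - 1` when counting from `0`). -/
def IsPlanar {N : ℕ} (κ : ℝ) (f : MvPolynomial (Fin N) ℝ) : Prop :=
  ∀ j : Fin N, 2 ≤ (j : ℕ) → dunkl κ j f = 0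

end PlanarHarmonic

end

/-! The Dunkl operators commute, so each `T_i` maps planar harmonics of degree `n + 1` to planar
harmonics of degree `n`. On planar polynomials `2 Δ_κ = (T_1 + T_2)² + (T_1 - T_2)²`; here `T_1 +
T_2` preserves parity under `(1,2)` and `T_1 - T_2` reverses it. The theorem follows from a ladder:
these two operators send `h_{n+1}^±` to explicit scalar multiples of `h_n^±`, the scalars being, up
to sign, `B_n = 2(Nκ + ⌈n/2⌉ + 1)` and `V_n = (N-1)κ + ⌈n/2⌉`. Since `κ > -1/N`, all of them are
positive except possibly `V_0`, which only ever multiplies `h_0^- = 0`.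

The ladder comes from `T_i p_n(x_i) = (n + Nκ) p_{n-1}(x_i)` and `T_j p_n(x_i) = 0` for `j ≠ i`,
together with a correction `±κ r_{a,b}` on products `p_a(x_1) p_b(x_2)`. In the generating functions
`p_1^a p_2^b` has coefficient the Chebyshev polynomial `T_{a-b}(s)` for `φ` and `U_{a-b-1}(s)` for
`ψ`. A combination `∑ l_j φ_{nj}` is thus the image under the linear functional on `ℝ[s]` with
moments `l_j`. Chebyshev identities turn `T_1 ± T_2` into first order differential operators in `s`,
hence into recurrences on moments, and the relations between `g^o` and `g^e` say that the given
coefficients satisfy them (`gOdd_gEven_succ`, `gOdd_gEven_shift`).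

Harmonicity follows because the two second order contributions cancel on the ladder. Conversely, let
`f` be planar harmonic of definite parity. Subtracting a multiple of `h_n^±` makes one of `T_1 ±
T_2` kill it. By induction the other one gives a multiple of `h_{n-1}^-`, which `T_1 - T_2`
annihilates, so that multiple is zero. Then every `T_i` kills the remainder, which vanishes because
there are no singular polynomials of positive degree for `κ > -1/N`
(`eq_zero_of_forall_dunkl_eq_zero`). -/

noncomputable section

namespace PlanarHarmonic

open MvPolynomial

/-! ### Divided differences and commutativity of the Dunkl operators -/

section Dunkl

variable {N : ℕ} {κ : ℝ}

theorem X_sub_X_ne_zero {i j : Fin N} (h : i ≠ j) :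
    (X i - X j : MvPolynomial (Fin N) ℝ) ≠ 0 :=
  sub_ne_zero.2 fun e => h (X_injective e)

/-- The quotient is obtained by choice, so identities for it are proved by cancelling `X i - X j`.
-/
theorem divDiff_unique {i j : Fin N} (h : i ≠ j) {f g : MvPolynomial (Fin N) ℝ}
    (hg : f - rename (Equiv.swap i j) f = (X i - X j) * g) : divDiff i j f = g :=
  mul_left_cancel₀ (X_sub_X_ne_zero h) (by rw [← divDiff_spec, hg])

theorem divDiff_add {i j : Fin N} (h : i ≠ j) (f g : MvPolynomial (Fin N) ℝ) :
    divDiff i j (f + g) = divDiff i j f + divDiff i j g :=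
  divDiff_unique h (by
    rw [map_add]; linear_combination divDiff_spec i j f + divDiff_spec i j g)

theorem divDiff_smul {i j : Fin N} (h : i ≠ j) (c : ℝ) (f : MvPolynomial (Fin N) ℝ) :
    divDiff i j (c • f) = c • divDiff i j f :=
  divDiff_unique h (by rw [map_smul, ← smul_sub, divDiff_spec, mul_smul_comm])

theorem divDiff_mul {i j : Fin N} (h : i ≠ j) (f g : MvPolynomial (Fin N) ℝ) :
    divDiff i j (f * g) =
      divDiff i j f * g + rename (Equiv.swap i j) f * divDiff i j g :=
  divDiff_unique h (by
    rw [map_mul]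
    linear_combination g * divDiff_spec i j f + rename (Equiv.swap i j) f * divDiff_spec i j g)

theorem divDiff_symm {i j : Fin N} (h : i ≠ j) (f : MvPolynomial (Fin N) ℝ) :
    divDiff j i f = -divDiff i j f :=
  divDiff_unique h.symm (by rw [Equiv.swap_comm]; linear_combination divDiff_spec i j f)

theorem divDiff_eq_zero {i j : Fin N} (h : i ≠ j) {f : MvPolynomial (Fin N) ℝ}
    (hf : rename (Equiv.swap i j) f = f) : divDiff i j f = 0 :=
  divDiff_unique h (by rw [hf]; ring)

theorem rename_swap_comm (σ : Equiv.Perm (Fin N)) (i j : Fin N) (f : MvPolynomial (Fin N) ℝ) :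
    rename σ (rename (Equiv.swap i j) f) = rename (Equiv.swap (σ i) (σ j)) (rename σ f) := by
  rw [rename_rename, rename_rename, ← Equiv.Perm.coe_mul, ← Equiv.Perm.coe_mul,
    Equiv.mul_swap_eq_swap_mul]

theorem rename_swap_swap (i j : Fin N) (f : MvPolynomial (Fin N) ℝ) :
    rename (Equiv.swap i j) (rename (Equiv.swap i j) f) = f := by
  rw [rename_rename, ← Equiv.Perm.coe_mul, Equiv.swap_mul_self, Equiv.Perm.coe_one, rename_id_apply]

theorem rename_divDiff (σ : Equiv.Perm (Fin N)) {i j : Fin N} (h : i ≠ j)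
    (f : MvPolynomial (Fin N) ℝ) :
    rename σ (divDiff i j f) = divDiff (σ i) (σ j) (rename σ f) := by
  refine (divDiff_unique (fun e => h (σ.injective e)) ?_).symm
  rw [← rename_swap_comm, ← map_sub, divDiff_spec]
  simp

/-- The Dunkl operator as a linear map. -/
def dunklHom (κ : ℝ) (i : Fin N) : MvPolynomial (Fin N) ℝ →ₗ[ℝ] MvPolynomial (Fin N) ℝ where
  toFun := dunkl κ i
  map_add' f g := by
    have : ∑ j ∈ Finset.univ.erase i, divDiff i j (f + g) =
        ∑ j ∈ Finset.univ.erase i, (divDiff i j f + divDiff i j g) :=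
      Finset.sum_congr rfl fun j hj => divDiff_add (Finset.ne_of_mem_erase hj).symm f g
    simp only [dunkl, map_add, this, Finset.sum_add_distrib]
    ring
  map_smul' c f := by
    have : ∑ j ∈ Finset.univ.erase i, divDiff i j (c • f) =
        ∑ j ∈ Finset.univ.erase i, c • divDiff i j f :=
      Finset.sum_congr rfl fun j hj => divDiff_smul (Finset.ne_of_mem_erase hj).symm c f
    simp only [dunkl, Derivation.map_smul, this, ← Finset.smul_sum, RingHom.id_apply, smul_add,
      mul_smul_comm]

theorem dunklHom_apply (i : Fin N) (f : MvPolynomial (Fin N) ℝ) :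
    dunklHom κ i f = dunkl κ i f := rfl

theorem rename_dunkl (σ : Equiv.Perm (Fin N)) (i : Fin N) (f : MvPolynomial (Fin N) ℝ) :
    rename σ (dunkl κ i f) = dunkl κ (σ i) (rename σ f) := by
  have h : rename σ (∑ j ∈ Finset.univ.erase i, divDiff i j f) =
      ∑ j ∈ Finset.univ.erase (σ i), divDiff (σ i) j (rename σ f) := by
    rw [map_sum]
    refine Finset.sum_bij (fun j _ => σ j) ?_ ?_ ?_ ?_
    · intro j hj; simpa using hj
    · intro a _ b _ e; exact σ.injective e
    · intro b hb
      exact ⟨σ.symm b, by simpa [Equiv.symm_apply_eq] using hb, by simp⟩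
    · intro j hj
      exact rename_divDiff σ (Finset.ne_of_mem_erase hj).symm f
  simp only [dunkl, map_add, map_mul, h, rename_C, pderiv_rename σ.injective]

/-- Clearing denominators turns relations between nested divided differences into linear relations
between permuted copies of `f`. -/
theorem mul_divDiff_divDiff (a b c d : Fin N) (f : MvPolynomial (Fin N) ℝ) :
    (X a - X b) * (X c - X d) * (X (Equiv.swap a b c) - X (Equiv.swap a b d)) *
        divDiff a b (divDiff c d f) =
      (X (Equiv.swap a b c) - X (Equiv.swap a b d)) * (f - rename (Equiv.swap c d) f) -
        (X c - X d) * (rename (Equiv.swap a b) f -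
          rename (Equiv.swap a b) (rename (Equiv.swap c d) f)) := by
  have h1 := divDiff_spec a b (divDiff c d f)
  have h2 := divDiff_spec c d f
  have h3 := congrArg (rename (Equiv.swap a b)) h2
  simp only [map_sub, map_mul, rename_X] at h3
  rw [h2, h3]
  linear_combination (-(X c - X d) * (X (Equiv.swap a b c) - X (Equiv.swap a b d))) * h1

theorem divDiff_comm_of_disjoint {i j k l : Fin N} (hik : i ≠ k) (hjl : j ≠ l) (hij : i ≠ j)
    (hil : i ≠ l) (hkj : k ≠ j) (hkl : k ≠ l) (f : MvPolynomial (Fin N) ℝ) :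
    divDiff i k (divDiff j l f) = divDiff j l (divDiff i k f) := by
  have h1 := mul_divDiff_divDiff i k j l f
  have h2 := mul_divDiff_divDiff j l i k f
  rw [Equiv.swap_apply_of_ne_of_ne hij.symm hkj.symm,
    Equiv.swap_apply_of_ne_of_ne hil.symm hkl.symm] at h1
  rw [Equiv.swap_apply_of_ne_of_ne hij hil, Equiv.swap_apply_of_ne_of_ne hkj hkl,
    rename_swap_comm, Equiv.swap_apply_of_ne_of_ne hij hil,
    Equiv.swap_apply_of_ne_of_ne hkj hkl] at h2
  apply mul_left_cancel₀ (mul_ne_zero (X_sub_X_ne_zero hik) (mul_ne_zero (X_sub_X_ne_zero hjl)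
    (mul_ne_zero (X_sub_X_ne_zero hik) (X_sub_X_ne_zero hjl))))
  linear_combination (X i - X k) * h1 - (X j - X l) * h2

/-- The classical Yang–Baxter relation for divided differences. -/
theorem divDiff_yangBaxter {i j k : Fin N} (hij : i ≠ j) (hik : i ≠ k) (hjk : j ≠ k)
    (f : MvPolynomial (Fin N) ℝ) :
    divDiff i j (divDiff j k f) + divDiff i k (divDiff j i f) + divDiff i k (divDiff j k f) =
      divDiff j k (divDiff i j f) + divDiff j i (divDiff i k f) + divDiff j k (divDiff i k f) := by
  -- Products of two distinct transpositions of `i, j, k` are the two 3-cycles, each factoring in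
  -- three ways. These conjugations bring each 3-cycle to a single form.
  have c1 := rename_swap_comm (Equiv.swap i j) j k f
  have c2 := rename_swap_comm (Equiv.swap i k) j i f
  have c3 := rename_swap_comm (Equiv.swap i k) j k f
  have c4 := rename_swap_comm (Equiv.swap j k) i j f
  have h1 := mul_divDiff_divDiff i j j k f
  have h2 := mul_divDiff_divDiff i k j i f
  have h3 := mul_divDiff_divDiff i k j k f
  have h4 := mul_divDiff_divDiff j k i j f
  have h5 := mul_divDiff_divDiff j i i k f
  have h6 := mul_divDiff_divDiff j k i k f
  simp only [Equiv.swap_apply_left, Equiv.swap_apply_right,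
    Equiv.swap_apply_of_ne_of_ne hij hik, Equiv.swap_apply_of_ne_of_ne hij.symm hjk,
    Equiv.swap_apply_of_ne_of_ne hik.symm hjk.symm,
    Equiv.swap_comm j i] at c1 c2 c3 c4 h1 h2 h3 h4 h5 h6
  apply mul_left_cancel₀ (mul_ne_zero (X_sub_X_ne_zero hij) (mul_ne_zero (X_sub_X_ne_zero hik)
    (X_sub_X_ne_zero hjk)))
  rw [c1, c2] at h1
  rw [c2] at h2
  rw [c3] at h3
  rw [c4, c3] at h4
  linear_combination h1 - h2 - h3 - h4 + h5 - h6

/-- The transposition exchanges `∂_i` and `∂_j`, and `∂_i + ∂_j` kills `x_i - x_j`. -/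
theorem pderiv_add_pderiv_divDiff {i j : Fin N} (h : i ≠ j) (f : MvPolynomial (Fin N) ℝ) :
    pderiv i (divDiff i j f) + pderiv j (divDiff i j f) =
      divDiff i j (pderiv i f) + divDiff i j (pderiv j f) := by
  rw [← divDiff_add h]
  refine (divDiff_unique h ?_).symm
  have h1 := congrArg (pderiv i) (divDiff_spec i j f)
  have h2 := congrArg (pderiv j) (divDiff_spec i j f)
  have e1 := pderiv_rename (Equiv.swap i j).injective i f
  have e2 := pderiv_rename (Equiv.swap i j).injective j f
  rw [Equiv.swap_apply_left] at e1
  rw [Equiv.swap_apply_right] at e2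
  simp only [map_sub, Derivation.leibniz, pderiv_X_self, pderiv_X_of_ne h, pderiv_X_of_ne h.symm,
    smul_eq_mul, e1, e2] at h1 h2
  rw [map_add]
  linear_combination h1 + h2

theorem pderiv_divDiff_of_ne {i j k : Fin N} (hjk : j ≠ k) (hij : i ≠ j) (hik : i ≠ k)
    (f : MvPolynomial (Fin N) ℝ) :
    pderiv i (divDiff j k f) = divDiff j k (pderiv i f) := by
  refine (divDiff_unique hjk ?_).symm
  have h1 := congrArg (pderiv i) (divDiff_spec j k f)
  have e1 := pderiv_rename (Equiv.swap j k).injective i f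
  rw [Equiv.swap_apply_of_ne_of_ne hij hik] at e1
  simp only [map_sub, Derivation.leibniz, pderiv_X_of_ne hij.symm, pderiv_X_of_ne hik.symm,
    smul_eq_mul, e1] at h1
  linear_combination h1

theorem divDiff_C_mul {i j : Fin N} (h : i ≠ j) (c : ℝ) (f : MvPolynomial (Fin N) ℝ) :
    divDiff i j (C c * f) = C c * divDiff i j f := by
  simp only [← smul_eq_C_mul, divDiff_smul h]

theorem divDiff_sum {ι : Type*} {i j : Fin N} (h : i ≠ j) (s : Finset ι)
    (f : ι → MvPolynomial (Fin N) ℝ) :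
    divDiff i j (∑ a ∈ s, f a) = ∑ a ∈ s, divDiff i j (f a) := by
  classical
  induction s using Finset.induction_on with
  | empty => simpa using divDiff_smul h 0 (0 : MvPolynomial (Fin N) ℝ)
  | insert a s ha ih => rw [Finset.sum_insert ha, Finset.sum_insert ha, divDiff_add h, ih]

/-- Sorts `T_i T_j` by powers of `κ`, with `S` the indices other than `i` and `j`, so that the
commutator can be treated one power at a time. -/
theorem dunkl_dunkl_expand {i j : Fin N} {S : Finset (Fin N)} (hij : i ≠ j)
    (ei : Finset.univ.erase i = insert j S) (ej : Finset.univ.erase j = insert i S)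
    (hiS : i ∉ S) (hjS : j ∉ S) (f : MvPolynomial (Fin N) ℝ) :
    dunkl κ i (dunkl κ j f) = pderiv i (pderiv j f) +
      C κ * (pderiv i (divDiff j i f) + divDiff i j (pderiv j f) +
        ∑ k ∈ S, (divDiff j k (pderiv i f) + divDiff i k (pderiv j f))) +
      C κ * (C κ * (divDiff i j (divDiff j i f) +
        ∑ k ∈ S, (divDiff i j (divDiff j k f) + divDiff i k (divDiff j i f)) +
        ∑ k ∈ S, ∑ l ∈ S, divDiff i k (divDiff j l f))) := by
  have hne : ∀ k ∈ S, i ≠ k ∧ j ≠ k := fun k hk =>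
    ⟨fun e => hiS (e ▸ hk), fun e => hjS (e ▸ hk)⟩
  have h1 : ∀ k, i ≠ k → divDiff i k (dunkl κ j f) = divDiff i k (pderiv j f) +
      C κ * (divDiff i k (divDiff j i f) + ∑ l ∈ S, divDiff i k (divDiff j l f)) := by
    intro k hk
    rw [dunkl, ej, Finset.sum_insert hiS, divDiff_add hk, divDiff_C_mul hk, divDiff_add hk,
      divDiff_sum hk]
  have h2 : ∑ k ∈ S, divDiff i k (dunkl κ j f) = ∑ k ∈ S, (divDiff i k (pderiv j f) +
      C κ * (divDiff i k (divDiff j i f) + ∑ l ∈ S, divDiff i k (divDiff j l f))) :=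
    Finset.sum_congr rfl fun k hk => h1 k (hne k hk).1
  have h3 : ∑ k ∈ S, pderiv i (divDiff j k f) = ∑ k ∈ S, divDiff j k (pderiv i f) :=
    Finset.sum_congr rfl fun k hk => pderiv_divDiff_of_ne (hne k hk).2 hij (hne k hk).1 f
  rw [dunkl, ei, Finset.sum_insert hjS, h1 j hij, h2, dunkl, ej, Finset.sum_insert hiS, map_add,
    pderiv_C_mul, map_add, map_sum, h3]
  simp only [Finset.sum_add_distrib, ← Finset.mul_sum]
  ring

theorem pderiv_pderiv_comm (i j : Fin N) (f : MvPolynomial (Fin N) ℝ) :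
    pderiv i (pderiv j f) = pderiv j (pderiv i f) := by
  have h : ⁅pderiv i, pderiv j⁆ = (0 : Derivation ℝ (MvPolynomial (Fin N) ℝ) _) :=
    derivation_ext fun k => by
      rw [Derivation.commutator_apply, pderiv_X, pderiv_X]
      simp [Pi.single_apply, apply_ite]
  have := congrArg (fun D : Derivation ℝ (MvPolynomial (Fin N) ℝ) _ => D f) h
  simpa [Derivation.commutator_apply, sub_eq_zero] using this

/-- At order `κ` the invariance of `∂_i + ∂_j` suffices. At order `κ²` the terms with four distinct
indices commute, and the remaining three-index terms cancel by the Yang–Baxter relation. -/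
theorem dunkl_comm (i j : Fin N) (f : MvPolynomial (Fin N) ℝ) :
    dunkl κ i (dunkl κ j f) = dunkl κ j (dunkl κ i f) := by
  rcases eq_or_ne i j with rfl | hij
  · rfl
  set S : Finset (Fin N) := (Finset.univ.erase i).erase j with hS
  have hiS : i ∉ S := by simp [hS]
  have hjS : j ∉ S := by simp [hS]
  have ei : Finset.univ.erase i = insert j S := by
    rw [hS, Finset.insert_erase (by simp [hij.symm])]
  have ej : Finset.univ.erase j = insert i S := by
    rw [hS, Finset.erase_right_comm, Finset.insert_erase (by simp [hij])]
  have hne : ∀ k ∈ S, i ≠ k ∧ j ≠ k := fun k hk =>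
    ⟨fun e => hiS (e ▸ hk), fun e => hjS (e ▸ hk)⟩
  rw [dunkl_dunkl_expand hij ei ej hiS hjS, dunkl_dunkl_expand hij.symm ej ei hjS hiS]
  have h1 : pderiv i (pderiv j f) = pderiv j (pderiv i f) :=
    pderiv_pderiv_comm i j f
  have h2 : pderiv i (divDiff j i f) + divDiff i j (pderiv j f) =
      pderiv j (divDiff i j f) + divDiff j i (pderiv i f) := by
    have := pderiv_add_pderiv_divDiff hij f
    rw [divDiff_symm hij f, divDiff_symm hij (pderiv i f), map_neg]
    linear_combination -this
  have h3 : divDiff i j (divDiff j i f) = divDiff j i (divDiff i j f) := by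
    have := divDiff_smul hij (-1) (divDiff i j f)
    simp only [neg_smul, one_smul] at this
    rw [divDiff_symm hij f, divDiff_symm hij (divDiff i j f), this]
  have h4 : ∑ k ∈ S, ∑ l ∈ S, divDiff i k (divDiff j l f) -
      ∑ k ∈ S, ∑ l ∈ S, divDiff j k (divDiff i l f) =
      ∑ k ∈ S, (divDiff i k (divDiff j k f) - divDiff j k (divDiff i k f)) := by
    rw [Finset.sum_comm (f := fun k l => divDiff j k (divDiff i l f)), ← Finset.sum_sub_distrib]
    refine Finset.sum_congr rfl fun k hk => ?_
    rw [← Finset.sum_sub_distrib]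
    refine Finset.sum_eq_single_of_mem k hk fun l hl hlk => ?_
    rw [divDiff_comm_of_disjoint (hne k hk).1 (hne l hl).2 hij (hne l hl).1 (hne k hk).2.symm
      hlk.symm, sub_self]
  have h5 : ∑ k ∈ S, (divDiff i j (divDiff j k f) + divDiff i k (divDiff j i f)) +
      ∑ k ∈ S, (divDiff i k (divDiff j k f) - divDiff j k (divDiff i k f)) =
      ∑ k ∈ S, (divDiff j i (divDiff i k f) + divDiff j k (divDiff i j f)) := by
    rw [← Finset.sum_add_distrib]
    refine Finset.sum_congr rfl fun k hk => ?_
    linear_combination divDiff_yangBaxter hij (hne k hk).1 (hne k hk).2 f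
  have h6 : ∑ k ∈ S, (divDiff j k (pderiv i f) + divDiff i k (pderiv j f)) =
      ∑ k ∈ S, (divDiff i k (pderiv j f) + divDiff j k (pderiv i f)) :=
    Finset.sum_congr rfl fun k _ => add_comm _ _
  linear_combination h1 + C κ * (h2 + h6) + C κ * C κ * (h3 + h4 + h5)

theorem homogeneousComponent_succ_mul {ℓ : MvPolynomial (Fin N) ℝ} (hℓ : ℓ.IsHomogeneous 1)
    (g : MvPolynomial (Fin N) ℝ) (n : ℕ) :
    homogeneousComponent (n + 1) (ℓ * g) = ℓ * homogeneousComponent n g := by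
  conv_lhs => rw [← sum_homogeneousComponent g, Finset.mul_sum, map_sum]
  have h : ∀ k, homogeneousComponent (n + 1) (ℓ * homogeneousComponent k g) =
      if k = n then ℓ * homogeneousComponent n g else 0 := by
    intro k
    have := homogeneousComponent_of_mem (m := n + 1)
      ((mem_homogeneousSubmodule _ _).2 (hℓ.mul (homogeneousComponent_isHomogeneous k g)))
    rw [this]
    by_cases hk : k = n
    · subst hk; simp [add_comm]
    · rw [if_neg hk, if_neg (by omega)]
  simp only [h, Finset.sum_ite_eq', Finset.mem_range]
  split_ifs with hn
  · rfl
  · rw [homogeneousComponent_eq_zero _ _ (by omega), mul_zero]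

/-- The degree `n` component of the quotient is itself a quotient, so uniqueness identifies the two.
-/
theorem isHomogeneous_divDiff {i j : Fin N} (h : i ≠ j) {f : MvPolynomial (Fin N) ℝ} {n : ℕ}
    (hf : f.IsHomogeneous (n + 1)) : (divDiff i j f).IsHomogeneous n := by
  have hx : (X i - X j : MvPolynomial (Fin N) ℝ).IsHomogeneous 1 :=
    (isHomogeneous_X ℝ i).sub (isHomogeneous_X ℝ j)
  have key : divDiff i j f = homogeneousComponent n (divDiff i j f) :=
    divDiff_unique h (by
      rw [← homogeneousComponent_succ_mul hx, ← divDiff_spec]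
      exact (homogeneousComponent_eq_self (hf.sub hf.rename_isHomogeneous)).symm)
  rw [key]
  exact homogeneousComponent_isHomogeneous _ _

theorem isHomogeneous_dunkl {i : Fin N} {f : MvPolynomial (Fin N) ℝ} {n : ℕ}
    (hf : f.IsHomogeneous (n + 1)) : (dunkl κ i f).IsHomogeneous n := by
  refine hf.pderiv.add (IsHomogeneous.C_mul (IsHomogeneous.sum _ _ _ fun j hj => ?_) κ)
  exact isHomogeneous_divDiff (Finset.ne_of_mem_erase hj).symm hf

theorem dunkl_eq_zero_of_isHomogeneous_zero {i : Fin N} {f : MvPolynomial (Fin N) ℝ}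
    (hf : f.IsHomogeneous 0) : dunkl κ i f = 0 := by
  obtain ⟨c, rfl⟩ : ∃ c, f = C c :=
    ⟨_, totalDegree_eq_zero_iff_eq_C.1 ((totalDegree_zero_iff_isHomogeneous _).2 hf)⟩
  rw [dunkl, pderiv_C, zero_add, Finset.sum_eq_zero, mul_zero]
  intro j hj
  exact divDiff_eq_zero (Finset.ne_of_mem_erase hj).symm (by simp)

end Dunkl

/-! ### Absence of singular polynomials for `κ > -1/N` -/

section Singular

variable {N : ℕ} {κ : ℝ}

/-- For commuting orthogonal involutions `A`, `B` the operator `(1 - A)(1 - B)` is positive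
semidefinite, so `1 - AB ≤ (1 - A) + (1 - B)`. -/
theorem sum_mul_sub_comp_comp_le {α β : Type*} [Fintype α] [Fintype β] {σ : Equiv.Perm α}
    {τ : Equiv.Perm β} (hσ : ∀ a, σ (σ a) = a) (hτ : ∀ b, τ (τ b) = b) (c : α → β → ℝ) :
    ∑ a, ∑ b, c a b * (c a b - c (σ a) (τ b)) ≤
      ∑ a, ∑ b, c a b * (c a b - c (σ a) b) + ∑ a, ∑ b, c a b * (c a b - c a (τ b)) := by
  have e0 : ∑ a, ∑ b, c a b * (c a b - c (σ a) b - c a (τ b) + c (σ a) (τ b)) =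
      ∑ a, ∑ b, c a b * (c a b - c (σ a) b) + ∑ a, ∑ b, c a b * (c a b - c a (τ b)) -
      ∑ a, ∑ b, c a b * (c a b - c (σ a) (τ b)) := by
    simp only [← Finset.sum_add_distrib, ← Finset.sum_sub_distrib]
    exact Finset.sum_congr rfl fun a _ => Finset.sum_congr rfl fun b _ => by ring
  set F : α → β → ℝ := fun a b => c a b * (c a b - c (σ a) b - c a (τ b) + c (σ a) (τ b)) with hF
  have shift : ∀ G : α → β → ℝ, ∑ a, ∑ b, G (σ a) b = ∑ a, ∑ b, G a b := fun G =>
    Equiv.sum_comp σ fun a => ∑ b, G a b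
  have shift' : ∀ G : α → β → ℝ, ∑ a, ∑ b, G a (τ b) = ∑ a, ∑ b, G a b := fun G =>
    Finset.sum_congr rfl fun a _ => Equiv.sum_comp τ fun b => G a b
  -- The bracket in `F` changes sign under `σ` and under `τ`, so the four translates of `F` add up
  -- to its square.
  have key : 4 * ∑ a, ∑ b, F a b =
      ∑ a, ∑ b, (c a b - c (σ a) b - c a (τ b) + c (σ a) (τ b)) ^ 2 := by
    have h : 4 * ∑ a, ∑ b, F a b = ∑ a, ∑ b, F a b + ∑ a, ∑ b, F (σ a) b +
        ∑ a, ∑ b, F a (τ b) + ∑ a, ∑ b, F (σ a) (τ b) := by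
      rw [shift F, shift' F, shift fun a b => F a (τ b), shift' F]; ring
    rw [h]
    simp only [← Finset.sum_add_distrib]
    refine Finset.sum_congr rfl fun a _ => Finset.sum_congr rfl fun b _ => ?_
    simp only [hF, hσ, hτ]
    ring
  have : 0 ≤ ∑ a, ∑ b, (c a b - c (σ a) b - c a (τ b) + c (σ a) (τ b)) ^ 2 :=
    Finset.sum_nonneg fun a _ => Finset.sum_nonneg fun b _ => sq_nonneg _
  linarith

theorem sum_mul_sub_swap (c : Fin N → ℝ) (i j : Fin N) :
    ∑ a, c a * (c a - c (Equiv.swap i j a)) = (c i - c j) ^ 2 := by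
  rcases eq_or_ne i j with rfl | hij
  · simp
  rw [Finset.sum_eq_add_of_mem i j (Finset.mem_univ _) (Finset.mem_univ _) hij]
  · rw [Equiv.swap_apply_left, Equiv.swap_apply_right]; ring
  · rintro a - ⟨h1, h2⟩
    rw [Equiv.swap_apply_of_ne_of_ne h1 h2]; ring

theorem sum_sum_sq_sub_le (c : Fin N → ℝ) :
    ∑ i, ∑ j, (c i - c j) ^ 2 ≤ 2 * N * ∑ i, c i ^ 2 := by
  have h : ∑ i, ∑ j, (c i - c j) ^ 2 = 2 * N * ∑ i, c i ^ 2 - 2 * (∑ i, c i) ^ 2 := by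
    simp only [sub_sq, Finset.sum_add_distrib, Finset.sum_sub_distrib, Finset.sum_const,
      Finset.card_univ, Fintype.card_fin, nsmul_eq_mul, ← Finset.mul_sum, ← Finset.sum_mul]
    ring
  rw [h]
  nlinarith [sq_nonneg (∑ i, c i)]

/-- The operator `∑ (1 - (i j))` on `n`-fold tensors is at most `2 N n`. -/
theorem sum_tensor_mul_sub_swap_le (n : ℕ) (c : (Fin n → Fin N) → ℝ) :
    ∑ i, ∑ j, ∑ w, c w * (c w - c (Equiv.swap i j ∘ w)) ≤ 2 * N * n * ∑ w, c w ^ 2 := by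
  induction n with
  | zero =>
    have : ∀ (i j : Fin N) (w : Fin 0 → Fin N), Equiv.swap i j ∘ w = w :=
      fun _ _ _ => Subsingleton.elim _ _
    simp [this]
  | succ n ih =>
    have split : ∀ F : (Fin (n + 1) → Fin N) → ℝ,
        ∑ w, F w = ∑ a : Fin N, ∑ w : Fin n → Fin N, F (Fin.cons a w) := by
      intro F
      rw [← Fintype.sum_prod_type']
      exact (Equiv.sum_comp (Fin.consEquiv fun _ => Fin N) F).symm
    have hcons : ∀ (i j a : Fin N) (w : Fin n → Fin N),
        Equiv.swap i j ∘ (Fin.cons a w : Fin (n + 1) → Fin N) =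
          Fin.cons (Equiv.swap i j a) (Equiv.swap i j ∘ w) := by
      intro i j a w
      exact (Fin.comp_cons (Equiv.swap i j) a w)
    set d : Fin N → (Fin n → Fin N) → ℝ := fun a w => c (Fin.cons a w) with hd
    -- Splitting off the first tensor factor: that factor contributes at most `2N`, the others at
    -- most `2Nn` by induction.
    have h1 : ∀ i j : Fin N, ∑ w, c w * (c w - c (Equiv.swap i j ∘ w)) ≤
        ∑ a, ∑ w, d a w * (d a w - d (Equiv.swap i j a) w) +
          ∑ a, ∑ w, d a w * (d a w - d a (Equiv.swap i j ∘ w)) := by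
      intro i j
      rw [split]
      simp only [hcons]
      exact sum_mul_sub_comp_comp_le (σ := Equiv.swap i j)
        (τ := Equiv.piCongrRight fun _ => Equiv.swap i j) (by simp)
        (fun w => by ext k; simp) d
    have h2 : ∑ i, ∑ j, ∑ a, ∑ w, d a w * (d a w - d (Equiv.swap i j a) w) ≤
        2 * N * ∑ a, ∑ w, d a w ^ 2 := by
      have e : ∑ i, ∑ j, ∑ a, ∑ w, d a w * (d a w - d (Equiv.swap i j a) w) =
          ∑ w, ∑ i, ∑ j, (d i w - d j w) ^ 2 := by
        rw [Finset.sum_comm (s := (Finset.univ : Finset (Fin n → Fin N)))]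
        refine Finset.sum_congr rfl fun i _ => ?_
        rw [Finset.sum_comm (s := (Finset.univ : Finset (Fin n → Fin N)))]
        refine Finset.sum_congr rfl fun j _ => ?_
        rw [Finset.sum_comm]
        exact Finset.sum_congr rfl fun w _ => sum_mul_sub_swap (fun a => d a w) i j
      rw [e, Finset.sum_comm (γ := Fin N), Finset.mul_sum]
      exact Finset.sum_le_sum fun w _ => sum_sum_sq_sub_le fun a => d a w
    have h3 : ∑ i, ∑ j, ∑ a, ∑ w, d a w * (d a w - d a (Equiv.swap i j ∘ w)) ≤
        2 * N * n * ∑ a, ∑ w, d a w ^ 2 := by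
      have e : ∑ i, ∑ j, ∑ a, ∑ w, d a w * (d a w - d a (Equiv.swap i j ∘ w)) =
          ∑ a, ∑ i, ∑ j, ∑ w, d a w * (d a w - d a (Equiv.swap i j ∘ w)) := by
        rw [Finset.sum_comm (f := fun a i => ∑ j, ∑ w, d a w * (d a w - d a (Equiv.swap i j ∘ w)))]
        exact Finset.sum_congr rfl fun i _ => Finset.sum_comm
      rw [e, Finset.mul_sum]
      exact Finset.sum_le_sum fun a _ => ih (d a)
    rw [split fun w => c w ^ 2]
    have h4 := Finset.sum_le_sum fun i (_ : i ∈ Finset.univ) =>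
      Finset.sum_le_sum fun j (_ : j ∈ Finset.univ) => h1 i j
    simp only [Finset.sum_add_distrib] at h4
    push_cast
    calc _ ≤ _ := h4
      _ ≤ _ := add_le_add h2 h3
      _ = _ := by ring

/-- A transposition acts as an orthogonal involution `A`, and `2⟨c, (1 - A)c⟩ = ‖(1 - A)c‖²`. -/
theorem sum_tensor_mul_sub_swap_nonneg (n : ℕ) (c : (Fin n → Fin N) → ℝ) (i j : Fin N) :
    0 ≤ ∑ w, c w * (c w - c (Equiv.swap i j ∘ w)) := by
  have h : ∑ w, c (Equiv.swap i j ∘ w) * (c (Equiv.swap i j ∘ w) - c w) =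
      ∑ w, c w * (c w - c (Equiv.swap i j ∘ w)) := by
    rw [← Equiv.sum_comp (Equiv.piCongrRight fun _ : Fin n => Equiv.swap i j)
      fun w => c w * (c w - c (Equiv.swap i j ∘ w))]
    refine Finset.sum_congr rfl fun w _ => ?_
    have e : Equiv.piCongrRight (fun _ : Fin n => Equiv.swap i j) w = Equiv.swap i j ∘ w := rfl
    have e' : Equiv.swap i j ∘ Equiv.swap i j ∘ w = w := by ext k; simp
    rw [e, e']
  have h2 : 2 * ∑ w, c w * (c w - c (Equiv.swap i j ∘ w)) =
      ∑ w, (c w - c (Equiv.swap i j ∘ w)) ^ 2 := by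
    rw [two_mul]
    nth_rewrite 1 [← h]
    rw [← Finset.sum_add_distrib]
    exact Finset.sum_congr rfl fun w _ => by ring
  have : 0 ≤ ∑ w, (c w - c (Equiv.swap i j ∘ w)) ^ 2 := Finset.sum_nonneg fun w _ => sq_nonneg _
  linarith

/-- The exponent of the monomial `∏ x_{w k}`. -/
def wordExponent {n : ℕ} (w : Fin n → Fin N) : Fin N →₀ ℕ := ∑ k, Finsupp.single (w k) 1

theorem exists_wordExponent_eq (n : ℕ) (α : Fin N →₀ ℕ) (hα : α.degree = n) :
    ∃ w : Fin n → Fin N, wordExponent w = α := by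
  induction n generalizing α with
  | zero =>
    exact ⟨Fin.elim0, by rw [(Finsupp.degree_eq_zero_iff α).1 hα]; simp [wordExponent]⟩
  | succ n ih =>
    obtain ⟨i, hi⟩ : ∃ i, α i ≠ 0 := by
      by_contra! h
      have : α = 0 := Finsupp.ext h
      simp [this] at hα
    have hle : Finsupp.single i 1 ≤ α := by
      rw [Finsupp.single_le_iff]; omega
    have hadd := add_tsub_cancel_of_le hle
    obtain ⟨w, hw⟩ := ih (α - Finsupp.single i 1) (by
      have := congrArg Finsupp.degree hadd
      rw [map_add, Finsupp.degree_single, hα] at this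
      omega)
    refine ⟨Fin.cons i w, ?_⟩
    rw [← hadd, ← hw]
    simp [wordExponent, Fin.sum_univ_succ]

/-- Reading off coefficients along words embeds degree `n` polynomials into `n`-fold tensors
compatibly with transpositions, which makes the tensor bounds available. -/
theorem coeff_wordExponent_rename_swap {n : ℕ} (i j : Fin N) (w : Fin n → Fin N)
    (f : MvPolynomial (Fin N) ℝ) :
    coeff (wordExponent w) (rename (Equiv.swap i j) f) =
      coeff (wordExponent (Equiv.swap i j ∘ w)) f := by
  rw [← coeff_rename_mapDomain (Equiv.swap i j) (Equiv.swap i j).injective f]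
  congr 1
  simp [wordExponent, Finsupp.mapDomain_finsetSum, Finsupp.mapDomain_single]

/-- The terms `(i,j)` and `(j,i)` combine by antisymmetry into `(x_i - x_j) divDiff i j f`; doubling
avoids ordering the pairs. -/
theorem two_mul_sum_X_mul_divDiff (f : MvPolynomial (Fin N) ℝ) :
    2 * ∑ i, X i * ∑ j ∈ Finset.univ.erase i, divDiff i j f =
      ∑ i, ∑ j, (f - rename (Equiv.swap i j) f) := by
  have h : ∀ i : Fin N, X i * ∑ j ∈ Finset.univ.erase i, divDiff i j f =
      ∑ j, if j = i then 0 else X i * divDiff i j f := by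
    intro i
    rw [Finset.mul_sum, ← Finset.filter_ne', Finset.sum_filter]
    exact Finset.sum_congr rfl fun j _ => by split_ifs <;> simp_all
  simp only [h]
  rw [two_mul]
  nth_rewrite 2 [Finset.sum_comm]
  rw [← Finset.sum_add_distrib]
  refine Finset.sum_congr rfl fun i _ => ?_
  rw [← Finset.sum_add_distrib]
  refine Finset.sum_congr rfl fun j _ => ?_
  by_cases hij : j = i
  · subst hij; simp
  · rw [if_neg hij, if_neg (Ne.symm hij), divDiff_spec, divDiff_symm (Ne.symm hij) f]
    ring

/-- There are no singular polynomials of positive degree when `κ > -1 / N`. -/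
theorem eq_zero_of_forall_dunkl_eq_zero (hκ : -1 / (N : ℝ) < κ) {n : ℕ} (hn : n ≠ 0)
    {f : MvPolynomial (Fin N) ℝ} (hf : f.IsHomogeneous n) (h : ∀ i, dunkl κ i f = 0) : f = 0 := by
  -- By Euler's identity this is twice `∑ x_i T_i f = 0`.
  have h1 : (2 * (n : ℝ)) • f + κ • ∑ i, ∑ j, (f - rename (Equiv.swap i j) f) = 0 := by
    have h0 : ∑ i, X i * dunkl κ i f = 0 := Finset.sum_eq_zero fun i _ => by rw [h, mul_zero]
    simp only [dunkl, mul_add, Finset.sum_add_distrib, hf.sum_X_mul_pderiv, mul_left_comm _ (C κ),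
      ← Finset.mul_sum] at h0
    rw [← two_mul_sum_X_mul_divDiff, smul_eq_C_mul, smul_eq_C_mul]
    rw [nsmul_eq_mul] at h0
    have e : (C (2 * (n : ℝ)) : MvPolynomial (Fin N) ℝ) = 2 * (n : MvPolynomial (Fin N) ℝ) := by
      rw [map_mul, map_natCast, map_ofNat]
    rw [e]
    linear_combination 2 * h0
  set c : (Fin n → Fin N) → ℝ := fun w => coeff (wordExponent w) f with hc
  have h2 : ∀ w, 2 * n * c w + κ * ∑ i, ∑ j, (c w - c (Equiv.swap i j ∘ w)) = 0 := by
    intro w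
    have := congrArg (coeff (wordExponent w)) h1
    simpa only [coeff_add, coeff_smul, coeff_sum, coeff_sub, coeff_wordExponent_rename_swap,
      smul_eq_mul, coeff_zero] using this
  have h3 : 2 * n * ∑ w, c w ^ 2 +
      κ * ∑ i, ∑ j, ∑ w, c w * (c w - c (Equiv.swap i j ∘ w)) = 0 := by
    have e : ∑ i, ∑ j, ∑ w, c w * (c w - c (Equiv.swap i j ∘ w)) =
        ∑ w, c w * ∑ i, ∑ j, (c w - c (Equiv.swap i j ∘ w)) := by
      simp only [Finset.mul_sum]
      rw [Finset.sum_comm (s := (Finset.univ : Finset (Fin n → Fin N)))]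
      exact Finset.sum_congr rfl fun i _ => Finset.sum_comm
    rw [e, Finset.mul_sum, Finset.mul_sum, ← Finset.sum_add_distrib]
    refine Finset.sum_eq_zero fun w _ => ?_
    linear_combination c w * h2 w
  have hup := sum_tensor_mul_sub_swap_le n c
  have hlow : 0 ≤ ∑ i, ∑ j, ∑ w, c w * (c w - c (Equiv.swap i j ∘ w)) :=
    Finset.sum_nonneg fun i _ => Finset.sum_nonneg fun j _ => sum_tensor_mul_sub_swap_nonneg n c i j
  have hsq : 0 ≤ ∑ w, c w ^ 2 := Finset.sum_nonneg fun w _ => sq_nonneg _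
  have hn' : (0 : ℝ) < n := by exact_mod_cast Nat.pos_of_ne_zero hn
  have hzero : ∑ w, c w ^ 2 = 0 := by
    -- The quadratic form `Q` of `∑ (1 - (i j))` lies between `0` and `2Nn ∑ c²`. For `κ ≥ 0` the
    -- lower bound suffices in `2n ∑ c² + κ Q = 0`; for `κ < 0` the upper bound gives `2n(1 + Nκ) ∑
    -- c² ≤ 0`.
    rcases le_or_gt 0 κ with h0 | h0
    · have := mul_nonneg h0 hlow
      nlinarith
    · rcases Nat.eq_zero_or_pos N with rfl | hN
      -- For `N = 0` the quotient `-1 / 0` is `0`, so `hκ` contradicts `κ < 0`.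
      · norm_num at hκ; linarith
      have hN' : (0 : ℝ) < N := by exact_mod_cast hN
      have h5 : 0 < 1 + N * κ := by
        rw [div_lt_iff₀ hN'] at hκ; linarith
      have h6 := mul_le_mul_of_nonpos_left hup h0.le
      have h7 : 2 * n * (1 + N * κ) * ∑ w, c w ^ 2 ≤ 0 := by linarith
      have h8 : 0 < 2 * n * (1 + N * κ) := by positivity
      exact le_antisymm (nonpos_of_mul_nonpos_right h7 h8) hsq
  have hcz : ∀ w, c w = 0 := fun w => by
    have := (Finset.sum_eq_zero_iff_of_nonneg fun w _ => sq_nonneg (c w)).1 hzero w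
      (Finset.mem_univ _)
    exact pow_eq_zero_iff two_ne_zero |>.1 this
  ext α
  rw [coeff_zero]
  by_cases hα : α.degree = n
  · obtain ⟨w, rfl⟩ := exists_wordExponent_eq n α hα
    exact hcz w
  · exact hf.coeff_eq_zero hα

end Singular

/-! ### The generating function of the polynomials `p_n(x_i; x)` -/

section Series

variable {N : ℕ} {κ : ℝ}

theorem poch_succ (a : ℝ) (k : ℕ) : poch a (k + 1) = poch a k * (a + k) := by
  simp [poch, ascPochhammer_succ_eval]

theorem poch_zero (a : ℝ) : poch a 0 = 1 := by simp [poch]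

theorem poch_one_left (k : ℕ) : poch 1 k = k.factorial := by
  induction k with
  | zero => simp [poch_zero]
  | succ k ih => rw [poch_succ, ih, Nat.factorial_succ]; push_cast; ring

theorem poch_pos {a : ℝ} (ha : 0 < a) (k : ℕ) : 0 < poch a k := ascPochhammer_pos k a ha

theorem poch_add_one_mul (a : ℝ) (k : ℕ) : poch (a + 1) k * a = poch a k * (a + k) := by
  induction k with
  | zero => simp [poch_zero]
  | succ k ih => rw [poch_succ, poch_succ]; push_cast; linear_combination (a + 1 + k) * ih

/-- Coefficientwise partial derivative of a power series. -/
def seriesPderiv (j : Fin N) (f : PowerSeries (MvPolynomial (Fin N) ℝ)) :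
    PowerSeries (MvPolynomial (Fin N) ℝ) :=
  PowerSeries.mk fun n => pderiv j (PowerSeries.coeff n f)

theorem coeff_seriesPderiv (j : Fin N) (n : ℕ) (f : PowerSeries (MvPolynomial (Fin N) ℝ)) :
    PowerSeries.coeff n (seriesPderiv j f) = pderiv j (PowerSeries.coeff n f) :=
  PowerSeries.coeff_mk _ _

theorem seriesPderiv_mul (j : Fin N) (f g : PowerSeries (MvPolynomial (Fin N) ℝ)) :
    seriesPderiv j (f * g) = seriesPderiv j f * g + f * seriesPderiv j g := by
  ext1 n
  simp only [coeff_seriesPderiv, PowerSeries.coeff_mul, map_add, map_sum, pderiv_mul,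
    Finset.sum_add_distrib]

theorem seriesPderiv_prod_eq_zero {ι : Type*} (j : Fin N) (s : Finset ι)
    (f : ι → PowerSeries (MvPolynomial (Fin N) ℝ)) (h : ∀ a ∈ s, seriesPderiv j (f a) = 0) :
    seriesPderiv j (∏ a ∈ s, f a) = 0 := by
  classical
  induction s using Finset.induction_on with
  | empty =>
    ext1 n
    rw [Finset.prod_empty, coeff_seriesPderiv, PowerSeries.coeff_one]
    split_ifs <;> simp
  | insert a s ha ih =>
    rw [Finset.prod_insert ha, seriesPderiv_mul, h a (Finset.mem_insert_self a s),
      ih fun b hb => h b (Finset.mem_insert_of_mem hb)]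
    simp

theorem oneSubPowNeg_one_eq (y : MvPolynomial (Fin N) ℝ) :
    oneSubPowNeg 1 y = 1 + PowerSeries.X * PowerSeries.C y * oneSubPowNeg 1 y := by
  ext1 n
  rw [map_add, mul_assoc]
  cases n with
  | zero => simp [oneSubPowNeg, poch_zero]
  | succ n =>
    rw [PowerSeries.coeff_succ_X_mul, PowerSeries.coeff_C_mul, PowerSeries.coeff_one]
    simp only [oneSubPowNeg, PowerSeries.coeff_mk, poch_one_left]
    rw [div_self (by positivity), div_self (by positivity)]
    simp [pow_succ']

theorem seriesPderiv_oneSubPowNeg_of_ne {j k : Fin N} (h : k ≠ j) :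
    seriesPderiv j (oneSubPowNeg κ (X k)) = 0 := by
  ext1 n
  rw [coeff_seriesPderiv]
  simp [oneSubPowNeg, pderiv_X_of_ne h]

/-- The differential equation `(1 - r x_j) ∂_j S = κ r S` of `S = (1 - r x_j)^(-κ)`, arranged
without division. -/
theorem seriesPderiv_oneSubPowNeg_self (j : Fin N) :
    seriesPderiv j (oneSubPowNeg κ (X j)) =
      PowerSeries.X * PowerSeries.C (C κ) * oneSubPowNeg κ (X j) +
        PowerSeries.X * PowerSeries.C (X j) * seriesPderiv j (oneSubPowNeg κ (X j)) := by
  have hc : ∀ n : ℕ, pderiv j (C (poch κ (n + 1) / ((n + 1).factorial : ℝ)) * X j ^ (n + 1)) =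
      C (poch κ n * (κ + n) / (n.factorial : ℝ)) * (X j ^ n : MvPolynomial (Fin N) ℝ) := by
    intro n
    have e : poch κ (n + 1) / ((n + 1).factorial : ℝ) * ((n : ℝ) + 1) =
        poch κ n * (κ + n) / (n.factorial : ℝ) := by
      rw [poch_succ, Nat.factorial_succ]
      push_cast
      field_simp
    rw [pderiv_C_mul, pderiv_pow, pderiv_X_self, ← e, map_mul]
    simp
    ring
  ext1 n
  rw [map_add, mul_assoc, mul_assoc]
  cases n with
  | zero =>
    rw [coeff_seriesPderiv]
    simp [oneSubPowNeg, poch_zero]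
  | succ n =>
    rw [PowerSeries.coeff_succ_X_mul, PowerSeries.coeff_succ_X_mul, PowerSeries.coeff_C_mul,
      PowerSeries.coeff_C_mul, coeff_seriesPderiv, coeff_seriesPderiv]
    simp only [oneSubPowNeg, PowerSeries.coeff_mk]
    rw [hc]
    cases n with
    | zero => simp [poch_zero]
    | succ n =>
      rw [hc, poch_succ, Nat.factorial_succ]
      rw [show poch κ n * (κ + n) * (κ + ((n + 1 : ℕ) : ℝ)) / (((n + 1) * n.factorial : ℕ) : ℝ) =
        κ * (poch κ n * (κ + n) / (((n + 1) * n.factorial : ℕ) : ℝ)) +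
          poch κ n * (κ + n) / (n.factorial : ℝ) by push_cast; field_simp]
      rw [map_add, map_mul]
      ring

/-- The series `∏ (1 - r x_j) ^ (-κ)`. -/
def prodSeries (N : ℕ) (κ : ℝ) : PowerSeries (MvPolynomial (Fin N) ℝ) :=
  ∏ j, oneSubPowNeg κ (X j)

/-- The coefficient of `r ^ n` in `∏ (1 - r x_j) ^ (-κ)`. -/
def prodPoly (N : ℕ) (κ : ℝ) (n : ℕ) : MvPolynomial (Fin N) ℝ :=
  PowerSeries.coeff n (prodSeries N κ)

theorem prodPoly_zero : prodPoly N κ 0 = 1 := by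
  simp [prodPoly, prodSeries, oneSubPowNeg, poch_zero, PowerSeries.coeff_zero_eq_constantCoeff,
    map_prod]

theorem pPoly_zero (i : Fin N) : pPoly κ i 0 = 1 := by
  have := prodPoly_zero (N := N) (κ := κ)
  rw [prodPoly, prodSeries] at this
  rw [PowerSeries.coeff_zero_eq_constantCoeff_apply] at this
  rw [pPoly, PowerSeries.coeff_zero_eq_constantCoeff_apply, map_mul, this]
  simp [oneSubPowNeg, poch_zero]

/-- Multiplying the generating function by `1 - r x_i` leaves `∏ (1 - r x_j)^(-κ)`. -/
theorem pPoly_succ (i : Fin N) (n : ℕ) :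
    pPoly κ i (n + 1) = X i * pPoly κ i n + prodPoly N κ (n + 1) := by
  have h : oneSubPowNeg 1 (X i) * prodSeries N κ = prodSeries N κ +
      PowerSeries.X * (PowerSeries.C (X i) * (oneSubPowNeg 1 (X i) * prodSeries N κ)) := by
    conv_lhs => rw [oneSubPowNeg_one_eq]
    ring
  rw [pPoly, ← prodSeries, h, map_add, PowerSeries.coeff_succ_X_mul, PowerSeries.coeff_C_mul,
    add_comm]
  rfl

theorem seriesPderiv_prodSeries (j : Fin N) :
    seriesPderiv j (prodSeries N κ) =
      PowerSeries.X * (PowerSeries.C (C κ) * (oneSubPowNeg 1 (X j) * prodSeries N κ)) := by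
  have h0 : prodSeries N κ = oneSubPowNeg κ (X j) *
      ∏ k ∈ Finset.univ.erase j, oneSubPowNeg κ (X k) :=
    (Finset.mul_prod_erase _ _ (Finset.mem_univ j)).symm
  have h1 := seriesPderiv_prod_eq_zero j (Finset.univ.erase j)
    (fun k => oneSubPowNeg κ (X k)) fun k hk =>
      seriesPderiv_oneSubPowNeg_of_ne (Finset.ne_of_mem_erase hk)
  have h2 := seriesPderiv_oneSubPowNeg_self (κ := κ) j
  have h3 := oneSubPowNeg_one_eq (X j : MvPolynomial (Fin N) ℝ)
  rw [h0, seriesPderiv_mul, h1, mul_zero, add_zero]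
  set D := seriesPderiv j (oneSubPowNeg κ (X j)) with hD
  set E := oneSubPowNeg 1 (X j : MvPolynomial (Fin N) ℝ) with hE
  set S := oneSubPowNeg κ (X j : MvPolynomial (Fin N) ℝ) with hS
  have h4 : D = PowerSeries.X * PowerSeries.C (C κ) * S * E := by
    linear_combination E * h2 - D * h3
  rw [h4]
  ring

theorem pderiv_prodPoly_succ (j : Fin N) (n : ℕ) :
    pderiv j (prodPoly N κ (n + 1)) = C κ * pPoly κ j n := by
  rw [prodPoly, ← coeff_seriesPderiv, seriesPderiv_prodSeries, PowerSeries.coeff_succ_X_mul,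
    PowerSeries.coeff_C_mul]
  rfl

theorem rename_prodPoly (σ : Equiv.Perm (Fin N)) (n : ℕ) :
    rename σ (prodPoly N κ n) = prodPoly N κ n := by
  have h : PowerSeries.map (rename σ : MvPolynomial (Fin N) ℝ →ₐ[ℝ] _).toRingHom
      (prodSeries N κ) = prodSeries N κ := by
    rw [prodSeries, map_prod]
    have : ∀ j, PowerSeries.map (rename σ : MvPolynomial (Fin N) ℝ →ₐ[ℝ] _).toRingHom
        (oneSubPowNeg κ (X j)) = oneSubPowNeg κ (X (σ j)) := by
      intro j
      ext1 n
      simp [oneSubPowNeg]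
    simp only [this]
    exact Equiv.prod_comp σ fun j => oneSubPowNeg κ (X j : MvPolynomial (Fin N) ℝ)
  conv_rhs => rw [prodPoly, ← h, PowerSeries.coeff_map]
  rfl

theorem rename_pPoly (σ : Equiv.Perm (Fin N)) (i : Fin N) (n : ℕ) :
    rename σ (pPoly κ i n) = pPoly κ (σ i) n := by
  induction n with
  | zero => simp [pPoly_zero]
  | succ n ih => rw [pPoly_succ, pPoly_succ, map_add, map_mul, rename_X, ih, rename_prodPoly]

theorem isHomogeneous_prodPoly (n : ℕ) : (prodPoly N κ n).IsHomogeneous n := by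
  suffices h : ∀ s : Finset (Fin N), ∀ n,
      (PowerSeries.coeff n (∏ j ∈ s, oneSubPowNeg κ (X j : MvPolynomial (Fin N) ℝ))).IsHomogeneous n
    from h _ n
  intro s
  classical
  induction s using Finset.induction_on with
  | empty =>
    intro n
    rw [Finset.prod_empty, PowerSeries.coeff_one]
    split_ifs with h
    · exact h ▸ isHomogeneous_one _ _
    · exact isHomogeneous_zero _ _ _
  | insert a s ha ih =>
    intro n
    rw [Finset.prod_insert ha, PowerSeries.coeff_mul]
    refine IsHomogeneous.sum _ _ _ fun x hx => ?_
    rw [← Finset.HasAntidiagonal.mem_antidiagonal.1 hx]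
    refine IsHomogeneous.mul ?_ (ih _)
    simp only [oneSubPowNeg, PowerSeries.coeff_mk]
    exact (isHomogeneous_X_pow a x.1).C_mul _

theorem isHomogeneous_pPoly (i : Fin N) (n : ℕ) : (pPoly κ i n).IsHomogeneous n := by
  induction n with
  | zero => rw [pPoly_zero]; exact isHomogeneous_one _ _
  | succ n ih =>
    rw [pPoly_succ]
    refine IsHomogeneous.add ?_ (isHomogeneous_prodPoly _)
    rw [add_comm]
    exact (isHomogeneous_X ℝ i).mul ih

/-- Euler's identity for `prodPoly`, whose partial derivatives are `κ p_n(x_k)`, combined with the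
recursion for `x_k p_n(x_k)`. -/
theorem sum_pPoly (n : ℕ) :
    C κ * ∑ k, pPoly κ k n = C (n + N * κ) * prodPoly N κ n := by
  cases n with
  | zero => simp [pPoly_zero, prodPoly_zero]; ring
  | succ n =>
    have h := (isHomogeneous_prodPoly (N := N) (κ := κ) (n + 1)).sum_X_mul_pderiv
    simp only [pderiv_prodPoly_succ] at h
    have h2 : ∀ k : Fin N, X k * (C κ * pPoly κ k n) =
        C κ * pPoly κ k (n + 1) - C κ * prodPoly N κ (n + 1) := by
      intro k; rw [pPoly_succ]; ring
    simp only [h2, Finset.sum_sub_distrib, Finset.sum_const, Finset.card_univ, Fintype.card_fin,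
      nsmul_eq_mul, ← Finset.mul_sum] at h
    push_cast at h ⊢
    simp only [map_add, map_mul, map_natCast, map_one]
    linear_combination h

end Series

/-! ### Dunkl operators on `p_a(x_i; x)` and on products of two of them -/

section Action

variable {N : ℕ} {κ : ℝ}

/-- The coefficients of `(1 - r x_i)⁻¹ (1 - r x_k)⁻¹ ∏ (1 - r x_j) ^ (-κ)`. -/
def qPoly (κ : ℝ) (i k : Fin N) : ℕ → MvPolynomial (Fin N) ℝ
  | 0 => 1
  | n + 1 => X i * qPoly κ i k n + pPoly κ k (n + 1)

theorem pPoly_one (i : Fin N) : pPoly κ i 1 = X i + prodPoly N κ 1 := by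
  rw [pPoly_succ, pPoly_zero, mul_one]

/-- Partial fractions in `r`. The same `qPoly` gives both the divided differences and the
derivatives of `p_n`, so the two can cancel. -/
theorem X_sub_X_mul_qPoly (i k : Fin N) (n : ℕ) :
    (X i - X k) * qPoly κ i k n = pPoly κ i (n + 1) - pPoly κ k (n + 1) := by
  induction n with
  | zero => rw [qPoly, pPoly_one, pPoly_one]; ring
  | succ n ih =>
    rw [qPoly, pPoly_succ i (n + 1), pPoly_succ k (n + 1)]
    linear_combination X i * ih

theorem pderiv_pPoly_of_ne {i j : Fin N} (h : i ≠ j) (n : ℕ) :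
    pderiv j (pPoly κ i (n + 1)) = C κ * qPoly κ i j n := by
  induction n with
  | zero =>
    rw [pPoly_one, map_add, pderiv_X_of_ne h, pderiv_prodPoly_succ, pPoly_zero, qPoly,
      zero_add]
  | succ n ih =>
    rw [pPoly_succ, map_add, pderiv_mul, pderiv_X_of_ne h, pderiv_prodPoly_succ, ih, qPoly]
    ring

theorem pderiv_pPoly_self (i : Fin N) (n : ℕ) :
    pderiv i (pPoly κ i (n + 1)) = qPoly κ i i n + C κ * qPoly κ i i n := by
  induction n with
  | zero =>
    rw [pPoly_one, map_add, pderiv_X_self, pderiv_prodPoly_succ, pPoly_zero, qPoly]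
  | succ n ih =>
    rw [pPoly_succ, map_add, pderiv_mul, pderiv_X_self, pderiv_prodPoly_succ, ih, qPoly]
    ring

theorem rename_swap_pPoly_of_ne {i j k : Fin N} (hj : i ≠ j) (hk : i ≠ k) (n : ℕ) :
    rename (Equiv.swap j k) (pPoly κ i n) = pPoly κ i n := by
  rw [rename_pPoly, Equiv.swap_apply_of_ne_of_ne hj hk]

theorem divDiff_pPoly_of_ne {i j k : Fin N} (hjk : j ≠ k) (hj : i ≠ j) (hk : i ≠ k) (n : ℕ) :
    divDiff j k (pPoly κ i n) = 0 :=
  divDiff_eq_zero hjk (rename_swap_pPoly_of_ne hj hk n)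

theorem divDiff_pPoly_zero {i j k : Fin N} (hjk : j ≠ k) : divDiff j k (pPoly κ i 0) = 0 :=
  divDiff_eq_zero hjk (by simp [pPoly_zero])

theorem divDiff_pPoly_left {i k : Fin N} (h : i ≠ k) (n : ℕ) :
    divDiff i k (pPoly κ i (n + 1)) = qPoly κ i k n :=
  divDiff_unique h (by rw [rename_pPoly, Equiv.swap_apply_left, X_sub_X_mul_qPoly])

theorem divDiff_pPoly_right {i k : Fin N} (h : i ≠ k) (n : ℕ) :
    divDiff i k (pPoly κ k n) = -divDiff i k (pPoly κ i n) :=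
  divDiff_unique h (by
    have := divDiff_spec i k (pPoly κ i n)
    rw [rename_pPoly, Equiv.swap_apply_left] at this
    rw [rename_pPoly, Equiv.swap_apply_right]
    linear_combination -this)

/-- The derivative contributes `κ q`; the only divided difference that survives, in direction `i`,
contributes `-κ q`. -/
theorem dunkl_pPoly_of_ne {i j : Fin N} (h : i ≠ j) (n : ℕ) : dunkl κ j (pPoly κ i n) = 0 := by
  cases n with
  | zero => exact dunkl_eq_zero_of_isHomogeneous_zero (isHomogeneous_pPoly i 0)
  | succ n =>
    rw [dunkl, pderiv_pPoly_of_ne h, Finset.sum_eq_single_of_mem i (by simp [h])]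
    · rw [divDiff_symm h, divDiff_pPoly_left h]; ring
    · intro k hk hki
      exact divDiff_pPoly_of_ne (Finset.ne_of_mem_erase hk).symm h hki.symm _

/-- In `T_i p_{n+1}(x_i)` the derivative supplies an extra `κ q_{ii}`, which completes the sum over
`k ≠ i` to all `k`; that full sum is accessible through `sum_pPoly`. -/
theorem qPoly_sum (i : Fin N) (n : ℕ) :
    qPoly κ i i n + C κ * ∑ k, qPoly κ i k n = C (n + 1 + N * κ) * pPoly κ i n := by
  induction n with
  | zero =>
    simp [qPoly, pPoly_zero]; ring
  | succ n ih =>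
    have h := sum_pPoly (N := N) (κ := κ) (n + 1)
    simp only [qPoly, Finset.sum_add_distrib, ← Finset.mul_sum]
    have h2 := pPoly_succ (κ := κ) i n
    push_cast at h ⊢
    simp only [map_add, map_mul, map_natCast, map_one] at h ih ⊢
    linear_combination X i * ih + h - (n + 1 + N * C κ) * h2

theorem dunkl_pPoly_self (i : Fin N) (n : ℕ) :
    dunkl κ i (pPoly κ i (n + 1)) = C (n + 1 + N * κ) * pPoly κ i n := by
  have h : ∑ k ∈ Finset.univ.erase i, divDiff i k (pPoly κ i (n + 1)) =
      ∑ k ∈ Finset.univ.erase i, qPoly κ i k n :=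
    Finset.sum_congr rfl fun k hk => divDiff_pPoly_left (Finset.ne_of_mem_erase hk).symm n
  rw [dunkl, h, pderiv_pPoly_self, ← qPoly_sum,
    ← Finset.add_sum_erase _ _ (Finset.mem_univ i)]
  ring

/-- The Leibniz defect comes from replacing the transposed `f` by `f - (x_i - x_l) divDiff i l f`.
-/
theorem dunkl_mul (i : Fin N) (f g : MvPolynomial (Fin N) ℝ) :
    dunkl κ i (f * g) = dunkl κ i f * g + f * dunkl κ i g -
      C κ * ∑ l ∈ Finset.univ.erase i, (X i - X l) * divDiff i l f * divDiff i l g := by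
  have h : ∑ l ∈ Finset.univ.erase i, divDiff i l (f * g) = ∑ l ∈ Finset.univ.erase i,
      (divDiff i l f * g + f * divDiff i l g - (X i - X l) * divDiff i l f * divDiff i l g) := by
    refine Finset.sum_congr rfl fun l hl => ?_
    rw [divDiff_mul (Finset.ne_of_mem_erase hl).symm]
    linear_combination (-divDiff i l g) * divDiff_spec i l f
  simp only [dunkl, h, pderiv_mul, Finset.sum_add_distrib, Finset.sum_sub_distrib,
    ← Finset.sum_mul, ← Finset.mul_sum]
  ring

/-- The product `p_a(x_i; x) p_b(x_k; x)`. -/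
def pProd (κ : ℝ) (i k : Fin N) (a b : ℕ) : MvPolynomial (Fin N) ℝ := pPoly κ i a * pPoly κ k b

/-- The coefficients of `r u (G(r, u) - G(u, r)) / (r - u)`, where `G` is the generating function
of the products `p_a(x_i; x) p_b(x_k; x)`. -/
def rPoly (κ : ℝ) (i k : Fin N) (a b : ℕ) : MvPolynomial (Fin N) ℝ :=
  (X i - X k) * divDiff i k (pPoly κ i a) * divDiff i k (pPoly κ i b)

theorem rPoly_symm (i k : Fin N) (a b : ℕ) : rPoly κ i k a b = rPoly κ i k b a := by
  rw [rPoly, rPoly]; ring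

theorem rPoly_zero_left {i k : Fin N} (h : i ≠ k) (b : ℕ) : rPoly κ i k 0 b = 0 := by
  rw [rPoly, divDiff_pPoly_zero h]; ring

theorem rPoly_zero_right {i k : Fin N} (h : i ≠ k) (a : ℕ) : rPoly κ i k a 0 = 0 := by
  rw [rPoly, divDiff_pPoly_zero h]; ring

theorem rPoly_swap {i k : Fin N} (h : i ≠ k) (a b : ℕ) : rPoly κ k i a b = -rPoly κ i k a b := by
  rw [rPoly, rPoly, divDiff_symm h, divDiff_symm h, divDiff_pPoly_right h, divDiff_pPoly_right h]
  ring

theorem divDiff_pPoly_succ {i k : Fin N} (h : i ≠ k) (n : ℕ) :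
    divDiff i k (pPoly κ i (n + 1)) = X i * divDiff i k (pPoly κ i n) + pPoly κ k n := by
  rw [divDiff_pPoly_left h]
  cases n with
  | zero => rw [divDiff_pPoly_zero h, pPoly_zero, qPoly]; ring
  | succ n => rw [divDiff_pPoly_left h, qPoly]

/-- After one recursion step in each factor the terms with `x_i` cancel. This relation is what
converts sums of `rPoly` back into sums of products. -/
theorem rPoly_succ_sub {i k : Fin N} (h : i ≠ k) (a b : ℕ) :
    rPoly κ i k a (b + 1) - rPoly κ i k (a + 1) b = pProd κ i k a b - pProd κ i k b a := by
  have ha := divDiff_spec i k (pPoly κ i a)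
  have hb := divDiff_spec i k (pPoly κ i b)
  rw [rename_pPoly, Equiv.swap_apply_left] at ha hb
  rw [rPoly, rPoly, divDiff_pPoly_succ h, divDiff_pPoly_succ h, pProd, pProd]
  linear_combination pPoly κ k a * hb - pPoly κ k b * ha

theorem dunkl_pProd_left {i k : Fin N} (h : i ≠ k) (a b : ℕ) :
    dunkl κ i (pProd κ i k a b) =
      dunkl κ i (pPoly κ i a) * pPoly κ k b + C κ * rPoly κ i k a b := by
  rw [pProd, dunkl_mul, dunkl_pPoly_of_ne h.symm, Finset.sum_eq_single_of_mem k (by simp [h.symm])]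
  · rw [divDiff_pPoly_right h, rPoly]; ring
  · intro l hl hlk
    rw [divDiff_pPoly_of_ne (i := k) (Finset.ne_of_mem_erase hl).symm h.symm hlk.symm]; ring

/-- The correction has the opposite sign to that of `T_i`: it cancels in `T_i + T_k` and doubles in
`T_i - T_k`. -/
theorem dunkl_pProd_right {i k : Fin N} (h : i ≠ k) (a b : ℕ) :
    dunkl κ k (pProd κ i k a b) =
      pPoly κ i a * dunkl κ k (pPoly κ k b) - C κ * rPoly κ i k a b := by
  have := dunkl_pProd_left (κ := κ) h.symm b a
  rw [rPoly_swap h, rPoly_symm i k b a] at this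
  rw [pProd, mul_comm, ← pProd, this]; ring

theorem dunkl_pProd_of_ne {i j k : Fin N} (hi : i ≠ j) (hk : k ≠ j) (hik : i ≠ k) (a b : ℕ) :
    dunkl κ j (pProd κ i k a b) = 0 := by
  rw [pProd, dunkl_mul, dunkl_pPoly_of_ne hi, dunkl_pPoly_of_ne hk, Finset.sum_eq_zero]
  · ring
  · intro l hl
    by_cases hli : l = i
    · rw [divDiff_pPoly_of_ne (i := k) (Finset.ne_of_mem_erase hl).symm hk (hli ▸ hik.symm)]; ring
    · rw [divDiff_pPoly_of_ne (i := i) (Finset.ne_of_mem_erase hl).symm hi (Ne.symm hli)]; ring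

theorem isHomogeneous_pProd (i k : Fin N) (a b : ℕ) : (pProd κ i k a b).IsHomogeneous (a + b) :=
  (isHomogeneous_pPoly i a).mul (isHomogeneous_pPoly k b)

theorem rename_swap_pProd (i k : Fin N) (a b : ℕ) :
    rename (Equiv.swap i k) (pProd κ i k a b) = pProd κ i k b a := by
  rw [pProd, map_mul, rename_pPoly, rename_pPoly, Equiv.swap_apply_left, Equiv.swap_apply_right,
    mul_comm, pProd]

end Action

/-! ### `T_1 ± T_2` as recurrences on the moments of a functional on `ℝ[s]` -/

section Functionals

variable {N : ℕ} {κ : ℝ}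

/-- The sum of `c (a - b) p_a(x_i; x) p_b(x_k; x)` over `a + b = n`. -/
def weightedSum (κ : ℝ) (i k : Fin N) (n : ℕ) (c : ℤ → ℝ) : MvPolynomial (Fin N) ℝ :=
  ∑ x ∈ Finset.HasAntidiagonal.antidiagonal n, c (x.1 - x.2) • pProd κ i k x.1 x.2

theorem smul_weightedSum (i k : Fin N) (n : ℕ) (r : ℝ) (c : ℤ → ℝ) :
    r • weightedSum κ i k n c = weightedSum κ i k n fun d => r * c d := by
  simp only [weightedSum, Finset.smul_sum, smul_smul]

theorem weightedSum_add (i k : Fin N) (n : ℕ) (c c' : ℤ → ℝ) :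
    weightedSum κ i k n c + weightedSum κ i k n c' =
      weightedSum κ i k n fun d => c d + c' d := by
  simp only [weightedSum, ← Finset.sum_add_distrib, add_smul]

theorem rename_swap_weightedSum (i k : Fin N) (n : ℕ) (c : ℤ → ℝ) :
    rename (Equiv.swap i k) (weightedSum κ i k n c) =
      weightedSum κ i k n fun d => c (-d) := by
  rw [weightedSum, weightedSum, map_sum, ← Finset.Nat.sum_antidiagonal_swap]
  refine Finset.sum_congr rfl fun x _ => ?_
  rw [map_smul, rename_swap_pProd]
  simp

theorem isHomogeneous_weightedSum (i k : Fin N) (n : ℕ) (c : ℤ → ℝ) :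
    (weightedSum κ i k n c).IsHomogeneous n := by
  refine IsHomogeneous.sum _ _ _ fun x hx => ?_
  rw [smul_eq_C_mul, ← Finset.HasAntidiagonal.mem_antidiagonal.1 hx]
  exact (isHomogeneous_pProd i k _ _).C_mul _

theorem dunkl_weightedSum_of_ne {i j k : Fin N} (hi : i ≠ j) (hk : k ≠ j) (hik : i ≠ k) (n : ℕ)
    (c : ℤ → ℝ) : dunkl κ j (weightedSum κ i k n c) = 0 := by
  rw [← dunklHom_apply, weightedSum, map_sum]
  refine Finset.sum_eq_zero fun x _ => ?_
  rw [map_smul, dunklHom_apply, dunkl_pProd_of_ne hi hk hik, smul_zero]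

/-- The sum of `c (a - b) r_{a,b}` over `a + b = n`. -/
def weightedRSum (κ : ℝ) (i k : Fin N) (n : ℕ) (c : ℤ → ℝ) : MvPolynomial (Fin N) ℝ :=
  ∑ x ∈ Finset.HasAntidiagonal.antidiagonal n, c (x.1 - x.2) • rPoly κ i k x.1 x.2

theorem dunkl_weightedSum_left {i k : Fin N} (h : i ≠ k) (n : ℕ) (c : ℤ → ℝ) :
    dunkl κ i (weightedSum κ i k (n + 1) c) =
      ∑ x ∈ Finset.HasAntidiagonal.antidiagonal n,
        ((x.1 + 1 + N * κ) * c (x.1 - x.2 + 1)) • pProd κ i k x.1 x.2 +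
      κ • weightedRSum κ i k (n + 1) c := by
  have h0 : dunkl κ i (pPoly κ i 0) = 0 :=
    dunkl_eq_zero_of_isHomogeneous_zero (isHomogeneous_pPoly i 0)
  rw [← dunklHom_apply, weightedSum, map_sum]
  simp only [map_smul, dunklHom_apply, dunkl_pProd_left h, smul_add, Finset.sum_add_distrib]
  congr 1
  · rw [Finset.Nat.sum_antidiagonal_succ, h0, zero_mul, smul_zero, zero_add]
    refine Finset.sum_congr rfl fun x _ => ?_
    rw [dunkl_pPoly_self, mul_assoc, ← smul_eq_C_mul, smul_smul, pProd, mul_comm (c _)]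
    push_cast
    congr 3
    ring
  · rw [weightedRSum, Finset.smul_sum]
    refine Finset.sum_congr rfl fun x _ => ?_
    rw [← smul_eq_C_mul, smul_comm]

theorem dunkl_weightedSum_right {i k : Fin N} (h : i ≠ k) (n : ℕ) (c : ℤ → ℝ) :
    dunkl κ k (weightedSum κ i k (n + 1) c) =
      ∑ x ∈ Finset.HasAntidiagonal.antidiagonal n,
        ((x.2 + 1 + N * κ) * c (x.1 - x.2 - 1)) • pProd κ i k x.1 x.2 -
      κ • weightedRSum κ i k (n + 1) c := by
  have h0 : dunkl κ k (pPoly κ k 0) = 0 :=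
    dunkl_eq_zero_of_isHomogeneous_zero (isHomogeneous_pPoly k 0)
  rw [← dunklHom_apply, weightedSum, map_sum]
  simp only [map_smul, dunklHom_apply, dunkl_pProd_right h, smul_sub, Finset.sum_sub_distrib]
  congr 1
  · rw [Finset.Nat.sum_antidiagonal_succ', h0, mul_zero, smul_zero, zero_add]
    refine Finset.sum_congr rfl fun x _ => ?_
    rw [dunkl_pPoly_self, mul_left_comm, ← smul_eq_C_mul, smul_smul, pProd, mul_comm (c _)]
    push_cast
    congr 3
    ring
  · rw [weightedRSum, Finset.smul_sum]
    refine Finset.sum_congr rfl fun x _ => ?_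
    rw [← smul_eq_C_mul, smul_comm]

/-- With `a + b = n` and `d = a - b`, the factors are `a + 1 = (n + 2 + d)/2` and `b + 1 = (n + 2 -
d)/2`, while the `rPoly` terms cancel. -/
theorem dunkl_add_weightedSum {i k : Fin N} (h : i ≠ k) (n : ℕ) (c : ℤ → ℝ) :
    dunkl κ i (weightedSum κ i k (n + 1) c) + dunkl κ k (weightedSum κ i k (n + 1) c) =
      weightedSum κ i k n fun d => (n + 2 + 2 * N * κ) / 2 * (c (d + 1) + c (d - 1)) +
        d / 2 * (c (d + 1) - c (d - 1)) := by
  rw [dunkl_weightedSum_left h, dunkl_weightedSum_right h, add_add_sub_cancel,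
    ← Finset.sum_add_distrib, weightedSum]
  refine Finset.sum_congr rfl fun x hx => ?_
  rw [← add_smul, ← Finset.HasAntidiagonal.mem_antidiagonal.1 hx]
  congr 1
  push_cast
  ring

theorem dunkl_sub_weightedSum {i k : Fin N} (h : i ≠ k) (n : ℕ) (c : ℤ → ℝ) :
    dunkl κ i (weightedSum κ i k (n + 1) c) - dunkl κ k (weightedSum κ i k (n + 1) c) =
      (weightedSum κ i k n fun d => (n + 2 + 2 * N * κ) / 2 * (c (d + 1) - c (d - 1)) +
        d / 2 * (c (d + 1) + c (d - 1))) + (2 * κ) • weightedRSum κ i k (n + 1) c := by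
  have e : (weightedSum κ i k n fun d => (n + 2 + 2 * N * κ) / 2 * (c (d + 1) - c (d - 1)) +
        d / 2 * (c (d + 1) + c (d - 1))) =
      ∑ x ∈ Finset.HasAntidiagonal.antidiagonal n,
        ((x.1 + 1 + N * κ) * c (x.1 - x.2 + 1)) • pProd κ i k x.1 x.2 -
      ∑ x ∈ Finset.HasAntidiagonal.antidiagonal n,
        ((x.2 + 1 + N * κ) * c (x.1 - x.2 - 1)) • pProd κ i k x.1 x.2 := by
    rw [← Finset.sum_sub_distrib, weightedSum]
    refine Finset.sum_congr rfl fun x hx => ?_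
    rw [← sub_smul, ← Finset.HasAntidiagonal.mem_antidiagonal.1 hx]
    congr 1
    push_cast
    ring
  rw [dunkl_weightedSum_left h, dunkl_weightedSum_right h, e, mul_smul, two_smul]
  abel

/-- `rPoly` is symmetric in its two degrees and the weight is odd. -/
theorem weightedRSum_eq_zero {i k : Fin N} (n : ℕ) {c : ℤ → ℝ} (hc : ∀ d, c (-d) = -c d) :
    weightedRSum κ i k n c = 0 := by
  have h : weightedRSum κ i k n c = -weightedRSum κ i k n c := by
    conv_lhs => rw [weightedRSum, ← Finset.Nat.sum_antidiagonal_swap]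
    rw [weightedRSum, ← Finset.sum_neg_distrib]
    refine Finset.sum_congr rfl fun x _ => ?_
    rw [← neg_smul, ← hc, rPoly_symm]
    simp
  exact self_eq_neg.1 h

/-- Oddness antisymmetrises the products, `rPoly_succ_sub` applies, and summation by parts moves the
difference to `c`. The boundary terms vanish because `r_{0,b} = r_{a,0} = 0`. -/
theorem two_smul_weightedSum_of_odd {i k : Fin N} (h : i ≠ k) (n : ℕ) {c : ℤ → ℝ}
    (hc : ∀ d, c (-d) = -c d) :
    (2 : ℝ) • weightedSum κ i k n c =
      weightedRSum κ i k (n + 1) fun d => c (d + 1) - c (d - 1) := by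
  have h1 : weightedSum κ i k n c = -∑ x ∈ Finset.HasAntidiagonal.antidiagonal n,
      c (x.1 - x.2) • pProd κ i k x.2 x.1 := by
    rw [weightedSum, ← Finset.Nat.sum_antidiagonal_swap, ← Finset.sum_neg_distrib]
    refine Finset.sum_congr rfl fun x _ => ?_
    rw [← neg_smul, ← hc]
    simp
  have h2 : (2 : ℝ) • weightedSum κ i k n c = ∑ x ∈ Finset.HasAntidiagonal.antidiagonal n,
      c (x.1 - x.2) • (rPoly κ i k x.1 (x.2 + 1) - rPoly κ i k (x.1 + 1) x.2) := by
    rw [two_smul]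
    nth_rewrite 2 [h1]
    rw [weightedSum, ← sub_eq_add_neg, ← Finset.sum_sub_distrib]
    refine Finset.sum_congr rfl fun x _ => ?_
    rw [rPoly_succ_sub h, smul_sub]
  rw [h2]
  simp only [weightedRSum, sub_smul, smul_sub, Finset.sum_sub_distrib]
  rw [Finset.Nat.sum_antidiagonal_succ' (f := fun x : ℕ × ℕ =>
      c ((x.1 : ℤ) - x.2 + 1) • rPoly κ i k x.1 x.2),
    Finset.Nat.sum_antidiagonal_succ (f := fun x : ℕ × ℕ =>
      c ((x.1 : ℤ) - x.2 - 1) • rPoly κ i k x.1 x.2), rPoly_zero_left h, rPoly_zero_right h]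
  simp only [smul_zero, zero_add]
  congr 1 <;> refine Finset.sum_congr rfl fun x _ => ?_ <;> push_cast <;> congr 2 <;> ring

/-- The linear functional on `ℝ[s]` with moments `l`. -/
def moment (l : ℕ → ℝ) : Polynomial ℝ →ₗ[ℝ] ℝ :=
  Polynomial.lsum fun k => l k • LinearMap.id

theorem moment_monomial (l : ℕ → ℝ) (k : ℕ) (r : ℝ) :
    moment l (Polynomial.monomial k r) = l k * r := by
  simp [moment, Polynomial.lsum_apply, Polynomial.sum_monomial_index]

theorem moment_smul (r : ℝ) (l : ℕ → ℝ) (p : Polynomial ℝ) :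
    moment (fun k => r * l k) p = r * moment l p := by
  induction p using Polynomial.induction_on' with
  | add p q hp hq => rw [map_add, map_add, hp, hq, mul_add]
  | monomial k c => rw [moment_monomial, moment_monomial, mul_assoc]

/-- The operator sends `s^k` to `(ω + k) s^{k+1} - k s^{k-1}`; the recurrence is its transpose. At
`k = 0` the truncated `k - 1` is harmless because of the factor `k`. -/
theorem moment_raise {ω : ℝ} {l l' : ℕ → ℝ}
    (h : ∀ k, l' k = (ω + k) * l (k + 1) - k * l (k - 1)) (p : Polynomial ℝ) :
    moment l' p = moment l (Polynomial.C ω * Polynomial.X * p -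
      (1 - Polynomial.X ^ 2) * Polynomial.derivative p) := by
  induction p using Polynomial.induction_on' with
  | add p q hp hq =>
    rw [map_add, hp, hq, ← map_add, map_add Polynomial.derivative]
    congr 1; ring
  | monomial k c =>
    have e : Polynomial.C ω * Polynomial.X * Polynomial.monomial k c -
        (1 - Polynomial.X ^ 2) * Polynomial.derivative (Polynomial.monomial k c) =
        Polynomial.monomial (k + 1) ((ω + k) * c) - Polynomial.monomial (k - 1) (k * c) := by
      rw [Polynomial.derivative_monomial]
      cases k with
      | zero => simp [← Polynomial.C_mul_X_pow_eq_monomial]; ring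
      | succ k =>
        simp only [← Polynomial.C_mul_X_pow_eq_monomial, Nat.add_sub_cancel, map_mul, map_add,
          map_natCast]
        ring
    rw [e, map_sub, moment_monomial, moment_monomial, moment_monomial, h]
    ring

theorem moment_scale {ω : ℝ} {l l' : ℕ → ℝ} (h : ∀ k, l' k = (ω + k) * l k) (p : Polynomial ℝ) :
    moment l' p = moment l (Polynomial.C ω * p + Polynomial.X * Polynomial.derivative p) := by
  induction p using Polynomial.induction_on' with
  | add p q hp hq =>
    rw [map_add, hp, hq, ← map_add, map_add Polynomial.derivative]
    congr 1; ring
  | monomial k c =>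
    have e : Polynomial.C ω * Polynomial.monomial k c +
        Polynomial.X * Polynomial.derivative (Polynomial.monomial k c) =
        Polynomial.monomial k ((ω + k) * c) := by
      rw [Polynomial.derivative_monomial]
      cases k with
      | zero => simp [← Polynomial.C_mul_X_pow_eq_monomial]
      | succ k =>
        simp only [← Polynomial.C_mul_X_pow_eq_monomial, Nat.add_sub_cancel, map_mul, map_add,
          map_natCast]
        ring
    rw [e, moment_monomial, moment_monomial, h]
    ring

/-- Transpose of an operator with `s^k` going to `(ω + 1 + k) s^{k+2} - (ω + k) s^k`, plus `2κ` to
absorb the `rPoly` sum in `T_1 - T_2`. -/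
theorem moment_raise_two {ω : ℝ} {l l' : ℕ → ℝ}
    (h : ∀ k, l' k = (ω + 1 + k) * l (k + 2) - (ω + k - 2 * κ) * l k) (p : Polynomial ℝ) :
    moment l' p = moment l ((Polynomial.X ^ 2 - Polynomial.C ω * (1 - Polynomial.X ^ 2)) * p -
      Polynomial.X * (1 - Polynomial.X ^ 2) * Polynomial.derivative p +
        Polynomial.C (2 * κ) * p) := by
  induction p using Polynomial.induction_on' with
  | add p q hp hq =>
    rw [map_add, hp, hq, ← map_add, map_add Polynomial.derivative]
    congr 1; ring
  | monomial k c =>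
    have e : (Polynomial.X ^ 2 - Polynomial.C ω * (1 - Polynomial.X ^ 2)) *
          Polynomial.monomial k c - Polynomial.X * (1 - Polynomial.X ^ 2) *
          Polynomial.derivative (Polynomial.monomial k c) +
        Polynomial.C (2 * κ) * Polynomial.monomial k c =
        Polynomial.monomial (k + 2) ((ω + 1 + k) * c) -
          Polynomial.monomial k ((ω + k - 2 * κ) * c) := by
      rw [Polynomial.derivative_monomial]
      cases k with
      | zero =>
        simp only [← Polynomial.C_mul_X_pow_eq_monomial, map_mul, map_add, map_sub, map_one,
          Nat.cast_zero, map_zero]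
        ring
      | succ k =>
        simp only [← Polynomial.C_mul_X_pow_eq_monomial, Nat.add_sub_cancel, map_mul, map_add,
          map_sub, map_natCast, map_one]
        ring
    rw [e, map_sub, moment_monomial, moment_monomial, moment_monomial, h]
    ring

open Polynomial.Chebyshev in
/-- The image of `∑ φ_{nj} s ^ j` under the functional with moments `l`. -/
def phiSum (κ : ℝ) (i k : Fin N) (n : ℕ) (l : ℕ → ℝ) : MvPolynomial (Fin N) ℝ :=
  weightedSum κ i k n fun d => moment l (T ℝ d)

open Polynomial.Chebyshev in
/-- The image of `∑ ψ_{nj} s ^ j` under the functional with moments `l`. -/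
def psiSum (κ : ℝ) (i k : Fin N) (n : ℕ) (l : ℕ → ℝ) : MvPolynomial (Fin N) ℝ :=
  weightedSum κ i k n fun d => moment l (U ℝ (d - 1))

theorem smul_phiSum (i k : Fin N) (n : ℕ) (r : ℝ) (l : ℕ → ℝ) :
    r • phiSum κ i k n l = phiSum κ i k n fun j => r * l j := by
  simp only [phiSum, smul_weightedSum, moment_smul]

theorem smul_psiSum (i k : Fin N) (n : ℕ) (r : ℝ) (l : ℕ → ℝ) :
    r • psiSum κ i k n l = psiSum κ i k n fun j => r * l j := by
  simp only [psiSum, smul_weightedSum, moment_smul]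

theorem rename_swap_phiSum (i k : Fin N) (n : ℕ) (l : ℕ → ℝ) :
    rename (Equiv.swap i k) (phiSum κ i k n l) = phiSum κ i k n l := by
  simp only [phiSum, rename_swap_weightedSum, Polynomial.Chebyshev.T_neg]

theorem rename_swap_psiSum (i k : Fin N) (n : ℕ) (l : ℕ → ℝ) :
    rename (Equiv.swap i k) (psiSum κ i k n l) = -psiSum κ i k n l := by
  rw [← neg_one_smul ℝ (psiSum κ i k n l)]
  simp only [psiSum, rename_swap_weightedSum, Polynomial.Chebyshev.U_neg_sub_one, map_neg,
    smul_weightedSum, neg_one_mul]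

section Chebyshev

open Polynomial Polynomial.Chebyshev

/-- This and the next three identities replace shifts of the index `d` by differential operators in
`s`. For `s = cos θ`, with `T_d = cos dθ` and `U_{d-1} = sin dθ / sin θ`, they are addition formulas
and derivatives in `θ`. -/
theorem T_raise (w : ℝ) (d : ℤ) :
    (w / 2) • (T ℝ (d + 1) + T ℝ (d - 1)) + ((d : ℝ) / 2) • (T ℝ (d + 1) - T ℝ (d - 1)) =
      Polynomial.C w * Polynomial.X * T ℝ d -
        (1 - Polynomial.X ^ 2) * derivative (T ℝ d) := by
  have h1 := one_sub_X_sq_mul_derivative_T_eq_poly_in_T (R := ℝ) (d - 1)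
  have h2 := T_add_one ℝ d
  have e : (Polynomial.C (d : ℝ) : ℝ[X]) = (d : ℝ[X]) := by simp
  rw [sub_add_cancel] at h1
  push_cast at h1
  rw [h1, h2, Polynomial.smul_eq_C_mul, Polynomial.smul_eq_C_mul, ← e]
  have hw : (Polynomial.C w : ℝ[X]) = 2 * Polynomial.C (w / 2) := by
    rw [← Polynomial.C_ofNat, ← Polynomial.C_mul]; congr 1; ring
  have hd : (Polynomial.C (d : ℝ) : ℝ[X]) = 2 * Polynomial.C ((d : ℝ) / 2) := by
    rw [← Polynomial.C_ofNat, ← Polynomial.C_mul]; congr 1; ring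
  rw [hw, hd]
  ring

/-- The constant is `w + 1` rather than `w` because differentiating `1 / sin θ` produces an extra
multiple of `s`. -/
theorem U_raise (w : ℝ) (d : ℤ) :
    (w / 2) • (U ℝ (d + 1 - 1) + U ℝ (d - 1 - 1)) +
        ((d : ℝ) / 2) • (U ℝ (d + 1 - 1) - U ℝ (d - 1 - 1)) =
      Polynomial.C (w + 1) * Polynomial.X * U ℝ (d - 1) -
        (1 - Polynomial.X ^ 2) * derivative (U ℝ (d - 1)) := by
  have h1 := add_one_mul_T_eq_poly_in_U (R := ℝ) (d - 1)
  have h2 := U_add_one ℝ (d - 1)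
  have h3 := two_mul_T_eq_U_sub_U (R := ℝ) (d - 2)
  have e : (Polynomial.C (d : ℝ) : ℝ[X]) = (d : ℝ[X]) := by simp
  have hw : (Polynomial.C w : ℝ[X]) = 2 * Polynomial.C (w / 2) := by
    rw [← Polynomial.C_ofNat, ← Polynomial.C_mul]; congr 1; ring
  have hd : (Polynomial.C (d : ℝ) : ℝ[X]) = 2 * Polynomial.C ((d : ℝ) / 2) := by
    rw [← Polynomial.C_ofNat, ← Polynomial.C_mul]; congr 1; ring
  rw [sub_add_cancel] at h1 h2 h3
  rw [show d - 1 - 1 = d - 2 by ring] at h2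
  push_cast at h1
  rw [sub_add_cancel, ← e, hd] at h1
  rw [show d + 1 - 1 = d by ring, show d - 1 - 1 = d - 2 by ring, Polynomial.smul_eq_C_mul,
    Polynomial.smul_eq_C_mul, Polynomial.C_add, Polynomial.C_1, hw]
  linear_combination h1 + Polynomial.C (w / 2) * h2 - Polynomial.C ((d : ℝ) / 2) * h3

theorem U_lower (w : ℝ) (d : ℤ) :
    (w / 2) • (U ℝ (d + 1 - 1) - U ℝ (d - 1 - 1)) +
        ((d : ℝ) / 2) • (U ℝ (d + 1 - 1) + U ℝ (d - 1 - 1)) =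
      Polynomial.C w * T ℝ d + Polynomial.X * derivative (T ℝ d) := by
  have h1 := T_derivative_eq_U (R := ℝ) d
  have h2 := U_add_one ℝ (d - 1)
  have h3 := two_mul_T_eq_U_sub_U (R := ℝ) (d - 2)
  have e : (Polynomial.C (d : ℝ) : ℝ[X]) = (d : ℝ[X]) := by simp
  have hw : (Polynomial.C w : ℝ[X]) = 2 * Polynomial.C (w / 2) := by
    rw [← Polynomial.C_ofNat, ← Polynomial.C_mul]; congr 1; ring
  have hd : (Polynomial.C (d : ℝ) : ℝ[X]) = 2 * Polynomial.C ((d : ℝ) / 2) := by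
    rw [← Polynomial.C_ofNat, ← Polynomial.C_mul]; congr 1; ring
  rw [sub_add_cancel] at h2 h3
  rw [show d - 1 - 1 = d - 2 by ring] at h2
  rw [← e, hd] at h1
  rw [show d + 1 - 1 = d by ring, show d - 1 - 1 = d - 2 by ring, Polynomial.smul_eq_C_mul,
    Polynomial.smul_eq_C_mul, h1, hw]
  linear_combination Polynomial.C ((d : ℝ) / 2) * h2 - Polynomial.C (w / 2) * h3

theorem T_lower (w : ℝ) (d : ℤ) :
    (w / 2) • (T ℝ (d + 1) - T ℝ (d - 1)) + ((d : ℝ) / 2) • (T ℝ (d + 1) + T ℝ (d - 1)) =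
      (Polynomial.X ^ 2 - Polynomial.C w * (1 - Polynomial.X ^ 2)) * U ℝ (d - 1) -
        Polynomial.X * (1 - Polynomial.X ^ 2) * derivative (U ℝ (d - 1)) := by
  have h1 := add_one_mul_T_eq_poly_in_U (R := ℝ) (d - 1)
  have h2 := T_add_one ℝ d
  have h3 := T_eq_X_mul_T_sub_pol_U (R := ℝ) (d - 1)
  have e : (Polynomial.C (d : ℝ) : ℝ[X]) = (d : ℝ[X]) := by simp
  have hw : (Polynomial.C w : ℝ[X]) = 2 * Polynomial.C (w / 2) := by
    rw [← Polynomial.C_ofNat, ← Polynomial.C_mul]; congr 1; ring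
  have hd : (Polynomial.C (d : ℝ) : ℝ[X]) = 2 * Polynomial.C ((d : ℝ) / 2) := by
    rw [← Polynomial.C_ofNat, ← Polynomial.C_mul]; congr 1; ring
  rw [sub_add_cancel, show d - 1 + 2 = d + 1 by ring] at h3
  rw [sub_add_cancel] at h1
  push_cast at h1
  rw [sub_add_cancel, ← e, hd] at h1
  rw [Polynomial.smul_eq_C_mul, Polynomial.smul_eq_C_mul, hw]
  linear_combination Polynomial.X * h1 + 2 * Polynomial.C (w / 2) * h3 -
    Polynomial.C (w / 2) * h2 + Polynomial.C ((d : ℝ) / 2) * h2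

end Chebyshev

theorem dunkl_add_phiSum {i k : Fin N} (h : i ≠ k) (n : ℕ) {l l' : ℕ → ℝ}
    (hl : ∀ j : ℕ, l' j = (n + 2 + 2 * N * κ + j) * l (j + 1) - j * l (j - 1)) :
    dunkl κ i (phiSum κ i k (n + 1) l) + dunkl κ k (phiSum κ i k (n + 1) l) =
      phiSum κ i k n l' := by
  rw [phiSum, dunkl_add_weightedSum h, phiSum]
  congr 1
  funext d
  rw [moment_raise hl, ← T_raise]
  simp only [map_add, map_sub, map_smul, smul_eq_mul]

theorem dunkl_add_psiSum {i k : Fin N} (h : i ≠ k) (n : ℕ) {l l' : ℕ → ℝ}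
    (hl : ∀ j : ℕ, l' j = (n + 2 + 2 * N * κ + 1 + j) * l (j + 1) - j * l (j - 1)) :
    dunkl κ i (psiSum κ i k (n + 1) l) + dunkl κ k (psiSum κ i k (n + 1) l) =
      psiSum κ i k n l' := by
  rw [psiSum, dunkl_add_weightedSum h, psiSum]
  congr 1
  funext d
  rw [moment_raise hl, ← U_raise]
  simp only [map_add, map_sub, map_smul, smul_eq_mul]

theorem dunkl_sub_psiSum {i k : Fin N} (h : i ≠ k) (n : ℕ) {l l' : ℕ → ℝ}
    (hl : ∀ j : ℕ, l' j = (n + 2 + 2 * N * κ + j) * l j) :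
    dunkl κ i (psiSum κ i k (n + 1) l) - dunkl κ k (psiSum κ i k (n + 1) l) =
      phiSum κ i k n l' := by
  rw [psiSum, dunkl_sub_weightedSum h, phiSum, weightedRSum_eq_zero, smul_zero, add_zero]
  · congr 1
    funext d
    rw [moment_scale hl, ← U_lower]
    simp only [map_add, map_sub, map_smul, smul_eq_mul]
  · intro d
    rw [Polynomial.Chebyshev.U_neg_sub_one, map_neg]

theorem dunkl_sub_phiSum {i k : Fin N} (h : i ≠ k) (n : ℕ) {l l' : ℕ → ℝ}
    (hl : ∀ j : ℕ, l' j = (n + 2 + 2 * N * κ + 1 + j) * l (j + 2) -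
      (n + 2 + 2 * N * κ + j - 2 * κ) * l j) :
    dunkl κ i (phiSum κ i k (n + 1) l) - dunkl κ k (phiSum κ i k (n + 1) l) =
      psiSum κ i k n l' := by
  -- Since `2 T_d = U_d - U_{d-2}`, the even weight is half the difference of the odd weight
  -- `U_{d-1}`, so the `rPoly` sum is a `psiSum`.
  have e : weightedRSum κ i k (n + 1) (fun d => moment l (Polynomial.Chebyshev.T ℝ d)) =
      psiSum κ i k n l := by
    have h2 := two_smul_weightedSum_of_odd (κ := κ) h n
      (c := fun d => moment l (Polynomial.Chebyshev.U ℝ (d - 1))) fun d => by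
        rw [Polynomial.Chebyshev.U_neg_sub_one, map_neg]
    have h3 : ∀ d : ℤ, moment l (Polynomial.Chebyshev.U ℝ (d + 1 - 1)) -
        moment l (Polynomial.Chebyshev.U ℝ (d - 1 - 1)) =
        2 * moment l (Polynomial.Chebyshev.T ℝ d) := by
      intro d
      have := Polynomial.Chebyshev.two_mul_T_eq_U_sub_U (R := ℝ) (d - 2)
      rw [sub_add_cancel] at this
      rw [show d + 1 - 1 = d by ring, show d - 1 - 1 = d - 2 by ring, ← map_sub, ← this,
        two_mul, map_add, two_mul]
    simp only [h3] at h2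
    rw [psiSum]
    refine smul_right_injective _ (two_ne_zero' ℝ) ?_
    simp only [h2, weightedRSum, Finset.smul_sum, smul_smul]
  rw [phiSum, dunkl_sub_weightedSum h, e, smul_psiSum, psiSum, psiSum, weightedSum_add]
  congr 1
  funext d
  rw [moment_raise_two hl, map_add, ← T_lower, moment_smul, ← Polynomial.smul_eq_C_mul]
  simp only [map_add, map_sub, map_smul, smul_eq_mul]

end Functionals

/-! ### Chebyshev expansion of the generating functions `u₁` and `u₂` -/

section Symbols

/-- The series `∑ p_1 ^ a p_2 ^ b W (c + a - b) t ^ (a + b)`. -/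
def symbolSeries (W : ℤ → Polynomial (MvPolynomial (Fin 2) ℝ)) (c : ℤ) : GenSeries :=
  PowerSeries.mk fun n => ∑ x ∈ Finset.HasAntidiagonal.antidiagonal n,
    Polynomial.C (X 0 ^ x.1 * X 1 ^ x.2) * W (c + x.1 - x.2)

/-- The series `∑ p_2 ^ b W (c - b) t ^ b`. -/
def rowSeries (W : ℤ → Polynomial (MvPolynomial (Fin 2) ℝ)) (c : ℤ) : GenSeries :=
  PowerSeries.mk fun b => Polynomial.C (X 1 ^ b) * W (c - b)

variable {W : ℤ → Polynomial (MvPolynomial (Fin 2) ℝ)}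

theorem rowSeries_eq (c : ℤ) :
    rowSeries W c = PowerSeries.C (W c) + tVar * pVar 1 * rowSeries W (c - 1) := by
  ext1 n
  rw [map_add, tVar, mul_assoc, pVar]
  cases n with
  | zero => simp [rowSeries]
  | succ n =>
    rw [PowerSeries.coeff_succ_X_mul, PowerSeries.coeff_C_mul, PowerSeries.coeff_C,
      if_neg (Nat.succ_ne_zero n), zero_add]
    simp only [rowSeries, PowerSeries.coeff_mk]
    rw [← mul_assoc, ← map_mul, pow_succ']
    congr 2
    push_cast
    ring

theorem symbolSeries_eq (c : ℤ) :
    symbolSeries W c = rowSeries W c + tVar * pVar 0 * symbolSeries W (c + 1) := by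
  ext1 n
  rw [map_add, tVar, mul_assoc, pVar]
  cases n with
  | zero => simp [rowSeries, symbolSeries]
  | succ n =>
    rw [PowerSeries.coeff_succ_X_mul, PowerSeries.coeff_C_mul]
    simp only [rowSeries, symbolSeries, PowerSeries.coeff_mk]
    rw [Finset.Nat.sum_antidiagonal_succ, Finset.mul_sum]
    refine congrArg₂ (· + ·) (by simp) (Finset.sum_congr rfl fun x _ => ?_)
    rw [← mul_assoc, ← map_mul]
    refine congrArg₂ (· * ·) (congrArg _ (by ring)) (congrArg W (by push_cast; ring))

theorem rowSeries_add (hW : ∀ d, W (d + 1) + W (d - 1) = 2 * Polynomial.X * W d) (c : ℤ) :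
    rowSeries W (c + 1) + rowSeries W (c - 1) = 2 * sVar * rowSeries W c := by
  ext1 n
  have h2 : (2 * sVar : GenSeries) = PowerSeries.C (2 * Polynomial.X) := by
    rw [sVar, map_mul, map_ofNat]
  rw [map_add, h2, PowerSeries.coeff_C_mul]
  simp only [rowSeries, PowerSeries.coeff_mk]
  have := hW (c - n)
  rw [show c - (n : ℤ) + 1 = c + 1 - n by ring, show c - (n : ℤ) - 1 = c - 1 - n by ring] at this
  linear_combination Polynomial.C (X 1 ^ n) * this

theorem symbolSeries_add (hW : ∀ d, W (d + 1) + W (d - 1) = 2 * Polynomial.X * W d) (c : ℤ) :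
    symbolSeries W (c + 1) + symbolSeries W (c - 1) = 2 * sVar * symbolSeries W c := by
  ext1 n
  have h2 : (2 * sVar : GenSeries) = PowerSeries.C (2 * Polynomial.X) := by
    rw [sVar, map_mul, map_ofNat]
  rw [map_add, h2, PowerSeries.coeff_C_mul]
  simp only [symbolSeries, PowerSeries.coeff_mk]
  rw [← Finset.sum_add_distrib, Finset.mul_sum]
  refine Finset.sum_congr rfl fun x _ => ?_
  have := hW (c + x.1 - x.2)
  rw [show c + (x.1 : ℤ) - x.2 + 1 = c + 1 + x.1 - x.2 by ring,
    show c + (x.1 : ℤ) - x.2 - 1 = c - 1 + x.1 - x.2 by ring] at this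
  linear_combination Polynomial.C (X 0 ^ x.1 * X 1 ^ x.2) * this

/-- Peeling off one factor of `p_1` or `p_2` shifts `c`; the three-term recurrence eliminates the
shifted series and leaves one quadratic denominator for each variable. -/
theorem symbolSeries_eq_mul_uDenInv
    (hW : ∀ d, W (d + 1) + W (d - 1) = 2 * Polynomial.X * W d) (c : ℤ) :
    symbolSeries W c = (PowerSeries.C (W c) - tVar * pVar 1 * PowerSeries.C (W (c + 1)) -
      tVar * pVar 0 * (PowerSeries.C (W (c - 1)) - tVar * pVar 1 * PowerSeries.C (W c))) *
        uDenInv := by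
  have hinv : ((1 - 2 * sVar * tVar * pVar 0 + tVar ^ 2 * pVar 0 ^ 2) *
      (1 - 2 * sVar * tVar * pVar 1 + tVar ^ 2 * pVar 1 ^ 2)) * uDenInv = 1 := by
    refine PowerSeries.mul_invOfUnit _ _ ?_
    simp [tVar]
  have hrow : ∀ c, (1 - 2 * sVar * tVar * pVar 1 + tVar ^ 2 * pVar 1 ^ 2) * rowSeries W c =
      PowerSeries.C (W c) - tVar * pVar 1 * PowerSeries.C (W (c + 1)) := by
    intro c
    have h1 := rowSeries_eq (W := W) c
    have h2 := rowSeries_eq (W := W) (c + 1)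
    have h3 := rowSeries_add hW c
    rw [add_sub_cancel_right] at h2
    linear_combination h1 - tVar * pVar 1 * h2 + tVar * pVar 1 * h3
  have hsym : (1 - 2 * sVar * tVar * pVar 0 + tVar ^ 2 * pVar 0 ^ 2) * symbolSeries W c =
      rowSeries W c - tVar * pVar 0 * rowSeries W (c - 1) := by
    have h1 := symbolSeries_eq (W := W) c
    have h2 := symbolSeries_eq (W := W) (c - 1)
    have h3 := symbolSeries_add hW c
    rw [sub_add_cancel] at h2
    linear_combination h1 - tVar * pVar 0 * h2 + tVar * pVar 0 * h3
  have r1 := hrow c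
  have r2 := hrow (c - 1)
  rw [sub_add_cancel] at r2
  rw [← r1, ← r2]
  linear_combination (-symbolSeries W c) * hinv +
    (1 - 2 * sVar * tVar * pVar 1 + tVar ^ 2 * pVar 1 ^ 2) * uDenInv * hsym

theorem u₁_eq_symbolSeries : u₁ = symbolSeries (Polynomial.Chebyshev.T _) 0 := by
  rw [symbolSeries_eq_mul_uDenInv fun d => by rw [Polynomial.Chebyshev.T_add_one]; ring]
  rw [u₁]
  refine congrArg (· * uDenInv) ?_
  simp only [zero_add, zero_sub, Polynomial.Chebyshev.T_zero, Polynomial.Chebyshev.T_one,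
    Polynomial.Chebyshev.T_neg_one, map_one, sVar]
  ring

theorem u₂_eq_symbolSeries : u₂ = symbolSeries (Polynomial.Chebyshev.U _) (-1) := by
  rw [symbolSeries_eq_mul_uDenInv fun d => by rw [Polynomial.Chebyshev.U_add_one]; ring]
  rw [u₂]
  refine congrArg (· * uDenInv) ?_
  norm_num [Polynomial.Chebyshev.U_zero, Polynomial.Chebyshev.U_neg_one,
    Polynomial.Chebyshev.U_neg_two]
  ring

variable {N : ℕ} {κ : ℝ}

theorem fromSymbol_mul_C (hN : 2 ≤ N) (a b : ℕ) (r : ℝ) :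
    fromSymbol hN κ (X 0 ^ a * X 1 ^ b * C r) = r • pProd κ (fst hN) (snd hN) a b := by
  have h : (X 0 ^ a * X 1 ^ b * C r : MvPolynomial (Fin 2) ℝ) =
      r • basisMonomials (Fin 2) ℝ (Finsupp.single 0 a + Finsupp.single 1 b) := by
    rw [coe_basisMonomials, mul_comm, ← smul_eq_C_mul, X_pow_eq_monomial, X_pow_eq_monomial,
      monomial_mul, one_mul]
  rw [h, map_smul, fromSymbol, Module.Basis.constr_basis]
  simp [pProd]

theorem phi_eq_weightedSum (hN : 2 ≤ N) (n j : ℕ) :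
    phi hN κ n j = weightedSum κ (fst hN) (snd hN) n
      fun d => (Polynomial.Chebyshev.T ℝ d).coeff j := by
  rw [phi, u₁_eq_symbolSeries, symbolSeries, PowerSeries.coeff_mk, Polynomial.finsetSum_coeff,
    map_sum, weightedSum]
  refine Finset.sum_congr rfl fun x _ => ?_
  rw [Polynomial.coeff_C_mul, ← Polynomial.Chebyshev.map_T (C : ℝ →+* MvPolynomial (Fin 2) ℝ),
    Polynomial.coeff_map, fromSymbol_mul_C, zero_add]

theorem psi_eq_weightedSum (hN : 2 ≤ N) (n j : ℕ) :
    psi hN κ n j = weightedSum κ (fst hN) (snd hN) n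
      fun d => (Polynomial.Chebyshev.U ℝ (d - 1)).coeff j := by
  rw [psi, u₂_eq_symbolSeries, symbolSeries, PowerSeries.coeff_mk, Polynomial.finsetSum_coeff,
    map_sum, weightedSum]
  refine Finset.sum_congr rfl fun x _ => ?_
  rw [Polynomial.coeff_C_mul, ← Polynomial.Chebyshev.map_U (C : ℝ →+* MvPolynomial (Fin 2) ℝ),
    Polynomial.coeff_map, fromSymbol_mul_C, neg_add_eq_sub, sub_right_comm]

theorem moment_eq_sum_range (l : ℕ → ℝ) {p : Polynomial ℝ} {m : ℕ} (hp : p.natDegree < m) :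
    moment l p = ∑ k ∈ Finset.range m, l k * p.coeff k := by
  rw [moment, Polynomial.lsum_apply, Polynomial.sum_over_range' _ (by simp) _ hp]
  simp

theorem weightedSum_congr (i k : Fin N) (n : ℕ) {c c' : ℤ → ℝ}
    (h : ∀ d : ℤ, d.natAbs ≤ n → c d = c' d) :
    weightedSum κ i k n c = weightedSum κ i k n c' := by
  refine Finset.sum_congr rfl fun x hx => ?_
  have := Finset.HasAntidiagonal.mem_antidiagonal.1 hx
  rw [h _ (by omega)]

theorem weightedSum_sum {ι : Type*} (i k : Fin N) (n : ℕ) (s : Finset ι) (c : ι → ℤ → ℝ) :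
    ∑ a ∈ s, weightedSum κ i k n (c a) = weightedSum κ i k n fun d => ∑ a ∈ s, c a d := by
  simp only [weightedSum, Finset.sum_smul]
  exact Finset.sum_comm

theorem sum_smul_phi (hN : 2 ≤ N) {n m : ℕ} (hm : n < m) (l : ℕ → ℝ) :
    ∑ j ∈ Finset.range m, l j • phi hN κ n j = phiSum κ (fst hN) (snd hN) n l := by
  simp only [phi_eq_weightedSum, smul_weightedSum, weightedSum_sum]
  refine weightedSum_congr _ _ _ fun d hd => ?_
  rw [moment_eq_sum_range l (m := m)]
  rw [Polynomial.Chebyshev.natDegree_T]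
  omega

theorem sum_smul_psi (hN : 2 ≤ N) {n m : ℕ} (hm : n ≤ m) (l : ℕ → ℝ) :
    ∑ j ∈ Finset.range m, l j • psi hN κ n j = psiSum κ (fst hN) (snd hN) n l := by
  simp only [psi_eq_weightedSum, smul_weightedSum, weightedSum_sum]
  refine weightedSum_congr _ _ _ fun d hd => ?_
  -- For `d = 0` the polynomial is `U_{-1} = 0`, whose `natDegree` is `0` and hence not below `m`
  -- when `n = m = 0`.
  rcases eq_or_ne d 0 with rfl | h0
  · simp
  rw [moment_eq_sum_range l (m := m)]
  rw [Polynomial.Chebyshev.natDegree_U]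
  omega

/-- The sequence `c 0, 0, c 1, 0, …`. -/
def evenSeq (c : ℕ → ℝ) (k : ℕ) : ℝ := if Even k then c (k / 2) else 0

/-- The sequence `0, c 0, 0, c 1, …`. -/
def oddSeq (c : ℕ → ℝ) (k : ℕ) : ℝ := if Even k then 0 else c (k / 2)

theorem evenSeq_two_mul (c : ℕ → ℝ) (j : ℕ) : evenSeq c (2 * j) = c j := by simp [evenSeq]

theorem evenSeq_two_mul_add_one (c : ℕ → ℝ) (j : ℕ) : evenSeq c (2 * j + 1) = 0 := by
  simp [evenSeq]

theorem oddSeq_two_mul (c : ℕ → ℝ) (j : ℕ) : oddSeq c (2 * j) = 0 := by simp [oddSeq]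

theorem oddSeq_two_mul_add_one (c : ℕ → ℝ) (j : ℕ) : oddSeq c (2 * j + 1) = c j := by
  simp [oddSeq, show (2 * j + 1) / 2 = j by omega]

theorem sum_range_evenSeq_smul (c : ℕ → ℝ) (F : ℕ → MvPolynomial (Fin N) ℝ) (m : ℕ) :
    ∑ k ∈ Finset.range (2 * m), evenSeq c k • F k = ∑ j ∈ Finset.range m, c j • F (2 * j) := by
  induction m with
  | zero => simp
  | succ m ih =>
    rw [mul_add, mul_one, Finset.sum_range_succ, Finset.sum_range_succ, Finset.sum_range_succ, ih,
      evenSeq_two_mul, evenSeq_two_mul_add_one, zero_smul, add_zero]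

theorem sum_range_oddSeq_smul (c : ℕ → ℝ) (F : ℕ → MvPolynomial (Fin N) ℝ) (m : ℕ) :
    ∑ k ∈ Finset.range (2 * m), oddSeq c k • F k =
      ∑ j ∈ Finset.range m, c j • F (2 * j + 1) := by
  induction m with
  | zero => simp
  | succ m ih =>
    rw [mul_add, mul_one, Finset.sum_range_succ, Finset.sum_range_succ, Finset.sum_range_succ, ih,
      oddSeq_two_mul, oddSeq_two_mul_add_one, zero_smul, add_zero]

/-- The ratio `2 ^ (-j) a_j / (b)_j`. -/
def pochRatio (a : ℕ → ℝ) (b : ℝ) (j : ℕ) : ℝ := 1 / 2 ^ j * (a j / poch b j)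

theorem hMinusOdd_eq (hN : 2 ≤ N) (m : ℕ) :
    hMinusOdd hN κ m = psiSum κ (fst hN) (snd hN) (2 * m + 1)
      (evenSeq (pochRatio (fun j => (gOdd j).eval (N * κ - κ + m)) (N * κ + m + 2))) := by
  rw [← sum_smul_psi hN (m := 2 * (m + 1)) (by omega), sum_range_evenSeq_smul]
  rfl

theorem hMinusEven_eq (hN : 2 ≤ N) (m : ℕ) :
    hMinusEven hN κ m = psiSum κ (fst hN) (snd hN) (2 * m)
      (oddSeq (pochRatio (fun j => (gEven j).eval (N * κ - κ + m)) (N * κ + m + 2))) := by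
  rw [← sum_smul_psi hN (m := 2 * m) le_rfl, sum_range_oddSeq_smul]
  rfl

theorem hPlusOdd_eq (hN : 2 ≤ N) (m : ℕ) :
    hPlusOdd hN κ m = phiSum κ (fst hN) (snd hN) (2 * m + 1)
      (oddSeq (pochRatio (fun j => (gEven j).eval (N * κ - κ + m + 1)) (N * κ + m + 2))) := by
  rw [← sum_smul_phi hN (m := 2 * (m + 1)) (by omega), sum_range_oddSeq_smul]
  rfl

theorem hPlusEven_eq (hN : 2 ≤ N) (m : ℕ) :
    hPlusEven hN κ m = phiSum κ (fst hN) (snd hN) (2 * m)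
      (evenSeq (pochRatio (fun j => (gOdd j).eval (N * κ - κ + m)) (N * κ + m + 1))) := by
  rw [← sum_smul_phi hN (m := 2 * (m + 1)) (by omega), sum_range_evenSeq_smul]
  rfl

end Symbols

/-! ### Relations between `g^o` and `g^e`, and the coefficient recurrences -/

section Recurrences

/-- Eliminating either family from these first order relations returns the three-term recurrence of
the other. The ladder needs the mixed form because it passes between the families. -/
theorem gOdd_gEven_succ (v : ℝ) (j : ℕ) :
    (gOdd (j + 1)).eval v = v * (gEven j).eval v + (2 * j + 1) * (gOdd j).eval v ∧
      (gEven (j + 1)).eval v = (gOdd (j + 1)).eval v + (j + 1) * (gEven j).eval v := by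
  induction j with
  | zero => simp [gOdd, gEven]; ring
  | succ j ih =>
    obtain ⟨h1, h2⟩ := ih
    have e1 : (gOdd (j + 2)).eval v = (v + (3 * ((j : ℝ) + 1) + 1)) * (gOdd (j + 1)).eval v -
        ((j : ℝ) + 1) * (2 * ((j : ℝ) + 1) - 1) * (gOdd j).eval v := by
      rw [gOdd]
      simp only [Polynomial.eval_sub, Polynomial.eval_mul, Polynomial.eval_add, Polynomial.eval_X,
        Polynomial.eval_C]
    have e2 : (gEven (j + 2)).eval v = (v + (3 * ((j : ℝ) + 1) + 2)) * (gEven (j + 1)).eval v -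
        ((j : ℝ) + 1) * (2 * ((j : ℝ) + 1) + 1) * (gEven j).eval v := by
      rw [gEven]
      simp only [Polynomial.eval_sub, Polynomial.eval_mul, Polynomial.eval_add, Polynomial.eval_X,
        Polynomial.eval_C]
    have h3 : (gOdd (j + 2)).eval v = v * (gEven (j + 1)).eval v +
        (2 * ((j : ℝ) + 1) + 1) * (gOdd (j + 1)).eval v := by
      linear_combination e1 - v * h2 + ((j : ℝ) + 1) * h1
    refine ⟨by push_cast; exact h3, ?_⟩
    push_cast
    linear_combination e2 - h3 + (2 * (j : ℝ) + 3) * h2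

theorem gOdd_succ (v : ℝ) (j : ℕ) :
    (gOdd (j + 1)).eval v = v * (gEven j).eval v + (2 * j + 1) * (gOdd j).eval v :=
  (gOdd_gEven_succ v j).1

theorem gEven_succ (v : ℝ) (j : ℕ) :
    (gEven (j + 1)).eval v = (gOdd (j + 1)).eval v + (j + 1) * (gEven j).eval v :=
  (gOdd_gEven_succ v j).2

/-- Ladder steps that lower `m` in the argument change `v + 1` to `v`. The two relations carry each
other through the induction. -/
theorem gOdd_gEven_shift (v : ℝ) (j : ℕ) :
    (gOdd j).eval v = 2 * (gOdd j).eval (v + 1) - (gEven j).eval (v + 1) ∧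
      v * (gEven j).eval v =
        (v + j + 1) * (gEven j).eval (v + 1) - (2 * j + 1) * (gOdd j).eval (v + 1) := by
  induction j with
  | zero => simp [gOdd, gEven]; norm_num
  | succ j ih =>
    obtain ⟨h1, h2⟩ := ih
    have a := gOdd_succ v j
    have b := gEven_succ v j
    have a' := gOdd_succ (v + 1) j
    have b' := gEven_succ (v + 1) j
    have h3 : (gOdd (j + 1)).eval v =
        2 * (gOdd (j + 1)).eval (v + 1) - (gEven (j + 1)).eval (v + 1) := by
      linear_combination a + h2 + (2 * (j : ℝ) + 1) * h1 - a' + b'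
    refine ⟨h3, ?_⟩
    push_cast
    linear_combination v * b + v * h3 + ((j : ℝ) + 1) * h2 - (2 * v + j + 2) * b' +
      ((j : ℝ) + 1) * a'

/-- The weight `2 ^ (-j) / (b)_j`. -/
def pochWeight (b : ℝ) (j : ℕ) : ℝ := 1 / 2 ^ j / poch b j

theorem pochRatio_eq (a : ℕ → ℝ) (b : ℝ) (j : ℕ) : pochRatio a b j = a j * pochWeight b j := by
  rw [pochRatio, pochWeight]; ring

theorem pochWeight_succ {b : ℝ} (hb : 0 < b) (j : ℕ) :
    2 * (b + j) * pochWeight b (j + 1) = pochWeight b j := by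
  have h1 := (poch_pos hb j).ne'
  have h2 : b + j ≠ 0 := by positivity
  rw [pochWeight, pochWeight, poch_succ, pow_succ]
  field_simp

theorem pochWeight_add_one {b : ℝ} (hb : 0 < b) (j : ℕ) :
    (b + j) * pochWeight (b + 1) j = b * pochWeight b j := by
  have h1 := (poch_pos hb j).ne'
  have h2 := (poch_pos (by positivity : 0 < b + 1) j).ne'
  have h3 := poch_add_one_mul b j
  rw [pochWeight, pochWeight]
  field_simp
  linear_combination -h3

theorem pochWeight_add_one_eq {b : ℝ} (hb : 0 < b) (j : ℕ) :
    pochWeight (b + 1) j = 2 * b * pochWeight b (j + 1) := by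
  have h : b + j ≠ 0 := by positivity
  apply mul_left_cancel₀ h
  linear_combination pochWeight_add_one hb j - b * pochWeight_succ hb j

/-- This and the next five lemmas are the moment recurrences behind the ladder. With `b` and `v`
left free, the two for `T_1 + T_2` serve both `φ` and `ψ`. -/
theorem moment_raise_oddSeq {b : ℝ} (hb : 0 < b) (v : ℝ) (k : ℕ) :
    2 * b * evenSeq (pochRatio (fun j => (gOdd j).eval v) b) k =
      (2 * b + k) * oddSeq (pochRatio (fun j => (gEven j).eval (v + 1)) (b + 1)) (k + 1) -
        k * oddSeq (pochRatio (fun j => (gEven j).eval (v + 1)) (b + 1)) (k - 1) := by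
  obtain ⟨j, rfl | rfl⟩ := Nat.even_or_odd' k
  · rw [evenSeq_two_mul, oddSeq_two_mul_add_one]
    have hs := pochWeight_add_one hb j
    cases j with
    | zero => simp [pochRatio_eq, gOdd, gEven, pochWeight, poch_zero]
    | succ i =>
      rw [show 2 * (i + 1) - 1 = 2 * i + 1 by omega, oddSeq_two_mul_add_one]
      simp only [pochRatio_eq]
      have h1 := (gOdd_gEven_shift v (i + 1)).1
      have h2 := gEven_succ (v + 1) i
      have h3 := pochWeight_add_one_eq hb i
      push_cast at hs ⊢
      linear_combination 2 * b * pochWeight b (i + 1) * (h1 - 2 * h2) -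
        2 * (gEven (i + 1)).eval (v + 1) * hs +
        2 * ((i : ℝ) + 1) * (gEven i).eval (v + 1) * h3
  · rw [evenSeq_two_mul_add_one, show 2 * j + 1 + 1 = 2 * (j + 1) by ring, oddSeq_two_mul,
      Nat.add_sub_cancel, oddSeq_two_mul]
    ring

theorem moment_raise_evenSeq {b : ℝ} (hb : 0 < b) (v : ℝ) (k : ℕ) :
    v * oddSeq (pochRatio (fun j => (gEven j).eval v) b) k =
      (2 * b - 1 + k) * evenSeq (pochRatio (fun j => (gOdd j).eval v) b) (k + 1) -
        k * evenSeq (pochRatio (fun j => (gOdd j).eval v) b) (k - 1) := by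
  obtain ⟨j, rfl | rfl⟩ := Nat.even_or_odd' k
  · rw [evenSeq_two_mul_add_one, oddSeq_two_mul]
    cases j with
    | zero => simp
    | succ i =>
      rw [show 2 * (i + 1) - 1 = 2 * i + 1 by omega, evenSeq_two_mul_add_one]
      ring
  · rw [oddSeq_two_mul_add_one, show 2 * j + 1 + 1 = 2 * (j + 1) by ring, evenSeq_two_mul,
      Nat.add_sub_cancel, evenSeq_two_mul]
    simp only [pochRatio_eq]
    have h1 := gOdd_succ v j
    have h2 := pochWeight_succ hb j
    push_cast
    linear_combination (-pochWeight b j) * h1 - (gOdd (j + 1)).eval v * h2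

/-- For `k = 2j` the factor `2b + k` only moves the base of the Pochhammer symbol, so the numerators
are arbitrary. -/
theorem moment_scale_evenSeq {b : ℝ} (hb : 0 < b) (a : ℕ → ℝ) (k : ℕ) :
    2 * b * evenSeq (pochRatio a b) k = (2 * b + k) * evenSeq (pochRatio a (b + 1)) k := by
  obtain ⟨j, rfl | rfl⟩ := Nat.even_or_odd' k
  · rw [evenSeq_two_mul, evenSeq_two_mul, pochRatio_eq, pochRatio_eq]
    push_cast
    linear_combination (-2 * a j) * pochWeight_add_one hb j
  · rw [evenSeq_two_mul_add_one, evenSeq_two_mul_add_one]; ring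

theorem moment_scale_oddSeq {b : ℝ} (hb : 0 < b) (a : ℕ → ℝ) (k : ℕ) :
    2 * b * oddSeq (pochRatio a b) k = (2 * b - 1 + k) * oddSeq (pochRatio a (b + 1)) k := by
  obtain ⟨j, rfl | rfl⟩ := Nat.even_or_odd' k
  · rw [oddSeq_two_mul, oddSeq_two_mul]; ring
  · rw [oddSeq_two_mul_add_one, oddSeq_two_mul_add_one, pochRatio_eq, pochRatio_eq]
    push_cast
    linear_combination (-2 * a j) * pochWeight_add_one hb j

theorem moment_raise_two_oddSeq {b : ℝ} (hb : 0 < b) (v : ℝ) (k : ℕ) :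
    -v * oddSeq (pochRatio (fun j => (gEven j).eval v) b) k =
      (2 * b - 1 + k) * oddSeq (pochRatio (fun j => (gEven j).eval (v + 1)) b) (k + 2) -
        (2 * v + 2 + k) * oddSeq (pochRatio (fun j => (gEven j).eval (v + 1)) b) k := by
  obtain ⟨j, rfl | rfl⟩ := Nat.even_or_odd' k
  · rw [show 2 * j + 2 = 2 * (j + 1) by ring]
    simp only [oddSeq_two_mul]
    ring
  · rw [show 2 * j + 1 + 2 = 2 * (j + 1) + 1 by ring]
    simp only [oddSeq_two_mul_add_one, pochRatio_eq]
    have h1 := (gOdd_gEven_shift v j).2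
    have h2 := gEven_succ (v + 1) j
    have h3 := gOdd_succ (v + 1) j
    have h4 := pochWeight_succ hb j
    push_cast
    linear_combination (-pochWeight b j) * h1 - pochWeight b j * h2 - pochWeight b j * h3 -
      (gEven (j + 1)).eval (v + 1) * h4

theorem moment_raise_two_evenSeq {b : ℝ} (hb : 0 < b) (v : ℝ) (k : ℕ) :
    -(v + 1) * evenSeq (pochRatio (fun j => (gOdd j).eval v) b) k =
      (2 * b + k) * evenSeq (pochRatio (fun j => (gOdd j).eval (v + 1)) b) (k + 2) -
        (2 * v + 3 + k) * evenSeq (pochRatio (fun j => (gOdd j).eval (v + 1)) b) k := by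
  obtain ⟨j, rfl | rfl⟩ := Nat.even_or_odd' k
  · rw [show 2 * j + 2 = 2 * (j + 1) by ring]
    simp only [evenSeq_two_mul, pochRatio_eq]
    have h1 := (gOdd_gEven_shift v j).1
    have h3 := gOdd_succ (v + 1) j
    have h4 := pochWeight_succ hb j
    push_cast
    linear_combination (-(v + 1) * pochWeight b j) * h1 - pochWeight b j * h3 -
      (gOdd (j + 1)).eval (v + 1) * h4
  · rw [show 2 * j + 1 + 2 = 2 * (j + 1) + 1 by ring]
    simp only [evenSeq_two_mul_add_one]
    ring

end Recurrences

/-! ### The ladder relations between consecutive degrees -/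

section Ladder

variable {N : ℕ} {κ : ℝ}

theorem fst_ne_snd (hN : 2 ≤ N) : fst hN ≠ snd hN := by
  simp [fst, snd]

/-- In degree `n + 1` the constant is `n + 2 + 2Nκ`: for `n = 2m` it is `2b` with `b = Nκ + m + 1`,
and for `n = 2m + 1` it is `2b - 1` with `b = Nκ + m + 2`. -/
theorem dunkl_add_hPlusOdd (hN : 2 ≤ N) (m : ℕ) (hb : 0 < N * κ + m + 1) :
    dunkl κ (fst hN) (hPlusOdd hN κ m) + dunkl κ (snd hN) (hPlusOdd hN κ m) =
      (2 * (N * κ + m + 1)) • hPlusEven hN κ m := by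
  rw [hPlusOdd_eq, hPlusEven_eq, smul_phiSum]
  refine dunkl_add_phiSum (fst_ne_snd hN) (2 * m) fun k => ?_
  rw [moment_raise_oddSeq hb, show (N * κ + m + 1 + 1 : ℝ) = N * κ + m + 2 by ring]
  push_cast
  ring

theorem dunkl_add_hPlusEven (hN : 2 ≤ N) (m : ℕ) (hb : 0 < N * κ + m + 2) :
    dunkl κ (fst hN) (hPlusEven hN κ (m + 1)) + dunkl κ (snd hN) (hPlusEven hN κ (m + 1)) =
      (N * κ - κ + m + 1) • hPlusOdd hN κ m := by
  rw [hPlusOdd_eq, hPlusEven_eq, smul_phiSum]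
  refine dunkl_add_phiSum (fst_ne_snd hN) (2 * m + 1) fun k => ?_
  rw [moment_raise_evenSeq hb]
  push_cast
  rw [show (N * κ + (m + 1) + 1 : ℝ) = N * κ + m + 2 by ring, ← add_assoc (N * κ - κ)]
  ring

theorem dunkl_sub_hMinusOdd (hN : 2 ≤ N) (m : ℕ) (hb : 0 < N * κ + m + 1) :
    dunkl κ (fst hN) (hMinusOdd hN κ m) - dunkl κ (snd hN) (hMinusOdd hN κ m) =
      (2 * (N * κ + m + 1)) • hPlusEven hN κ m := by
  rw [hMinusOdd_eq, hPlusEven_eq, smul_phiSum]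
  refine dunkl_sub_psiSum (fst_ne_snd hN) (2 * m) fun k => ?_
  rw [moment_scale_evenSeq hb, show (N * κ + m + 1 + 1 : ℝ) = N * κ + m + 2 by ring]
  push_cast
  ring

theorem dunkl_sub_hMinusEven (hN : 2 ≤ N) (m : ℕ) (hb : 0 < N * κ + m + 2) :
    dunkl κ (fst hN) (hMinusEven hN κ (m + 1)) - dunkl κ (snd hN) (hMinusEven hN κ (m + 1)) =
      (2 * (N * κ + m + 2)) • hPlusOdd hN κ m := by
  rw [hMinusEven_eq, hPlusOdd_eq, smul_phiSum]
  refine dunkl_sub_psiSum (fst_ne_snd hN) (2 * m + 1) fun k => ?_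
  rw [moment_scale_oddSeq hb]
  push_cast
  rw [show (N * κ + (m + 1) + 2 : ℝ) = N * κ + m + 2 + 1 by ring, ← add_assoc (N * κ - κ)]
  ring

/-- Here `n + 2 + 2Nκ - 2κ = 2v + 2` with `v = Nκ - κ + m`; this is how the argument of the `g`
polynomials arises. -/
theorem dunkl_sub_hPlusOdd (hN : 2 ≤ N) (m : ℕ) (hb : 0 < N * κ + m + 2) :
    dunkl κ (fst hN) (hPlusOdd hN κ m) - dunkl κ (snd hN) (hPlusOdd hN κ m) =
      (-(N * κ - κ + m)) • hMinusEven hN κ m := by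
  rw [hPlusOdd_eq, hMinusEven_eq, smul_psiSum]
  refine dunkl_sub_phiSum (fst_ne_snd hN) (2 * m) fun k => ?_
  rw [moment_raise_two_oddSeq hb]
  push_cast
  ring

theorem dunkl_sub_hPlusEven (hN : 2 ≤ N) (m : ℕ) (hb : 0 < N * κ + m + 2) :
    dunkl κ (fst hN) (hPlusEven hN κ (m + 1)) - dunkl κ (snd hN) (hPlusEven hN κ (m + 1)) =
      (-(N * κ - κ + m + 1)) • hMinusOdd hN κ m := by
  rw [hPlusEven_eq, hMinusOdd_eq, smul_psiSum]
  refine dunkl_sub_phiSum (fst_ne_snd hN) (2 * m + 1) fun k => ?_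
  rw [moment_raise_two_evenSeq hb]
  push_cast
  rw [show (N * κ + (m + 1) + 1 : ℝ) = N * κ + m + 2 by ring, ← add_assoc (N * κ - κ)]
  ring

theorem dunkl_add_hMinusOdd (hN : 2 ≤ N) (m : ℕ) (hb : 0 < N * κ + m + 2) :
    dunkl κ (fst hN) (hMinusOdd hN κ m) + dunkl κ (snd hN) (hMinusOdd hN κ m) =
      (N * κ - κ + m) • hMinusEven hN κ m := by
  rw [hMinusOdd_eq, hMinusEven_eq, smul_psiSum]
  refine dunkl_add_psiSum (fst_ne_snd hN) (2 * m) fun k => ?_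
  rw [moment_raise_evenSeq hb]
  push_cast
  ring

theorem dunkl_add_hMinusEven (hN : 2 ≤ N) (m : ℕ) (hb : 0 < N * κ + m + 2) :
    dunkl κ (fst hN) (hMinusEven hN κ (m + 1)) + dunkl κ (snd hN) (hMinusEven hN κ (m + 1)) =
      (2 * (N * κ + m + 2)) • hMinusOdd hN κ m := by
  rw [hMinusEven_eq, hMinusOdd_eq, smul_psiSum]
  refine dunkl_add_psiSum (fst_ne_snd hN) (2 * m + 1) fun k => ?_
  rw [moment_raise_oddSeq hb]
  push_cast
  rw [show (N * κ + (m + 1) + 2 : ℝ) = N * κ + m + 2 + 1 by ring, ← add_assoc (N * κ - κ)]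
  ring

end Ladder

/-! ### Harmonicity, spanning and independence -/

section Main

variable {N : ℕ} {κ : ℝ}

theorem hPlus_two_mul (hN : 2 ≤ N) (m : ℕ) : hPlus hN κ (2 * m) = hPlusEven hN κ m := by
  simp [hPlus]

theorem hPlus_two_mul_add_one (hN : 2 ≤ N) (m : ℕ) :
    hPlus hN κ (2 * m + 1) = hPlusOdd hN κ m := by
  simp [hPlus, show (2 * m + 1) / 2 = m by omega]

theorem hMinus_two_mul (hN : 2 ≤ N) (m : ℕ) : hMinus hN κ (2 * m) = hMinusEven hN κ m := by
  simp [hMinus]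

theorem hMinus_two_mul_add_one (hN : 2 ≤ N) (m : ℕ) :
    hMinus hN κ (2 * m + 1) = hMinusOdd hN κ m := by
  simp [hMinus, show (2 * m + 1) / 2 = m by omega]

/-- Planarity, degree and parity hold for every choice of moments, so only this shape matters for
them. -/
theorem exists_hPlus_eq_phiSum (hN : 2 ≤ N) (n : ℕ) :
    ∃ l, hPlus hN κ n = phiSum κ (fst hN) (snd hN) n l := by
  obtain ⟨m, rfl | rfl⟩ := Nat.even_or_odd' n
  · exact ⟨_, (hPlus_two_mul hN m).trans (hPlusEven_eq hN m)⟩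
  · exact ⟨_, (hPlus_two_mul_add_one hN m).trans (hPlusOdd_eq hN m)⟩

theorem exists_hMinus_eq_psiSum (hN : 2 ≤ N) (n : ℕ) :
    ∃ l, hMinus hN κ n = psiSum κ (fst hN) (snd hN) n l := by
  obtain ⟨m, rfl | rfl⟩ := Nat.even_or_odd' n
  · exact ⟨_, (hMinus_two_mul hN m).trans (hMinusEven_eq hN m)⟩
  · exact ⟨_, (hMinus_two_mul_add_one hN m).trans (hMinusOdd_eq hN m)⟩

theorem isPlanar_weightedSum (hN : 2 ≤ N) (n : ℕ) (c : ℤ → ℝ) :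
    IsPlanar κ (weightedSum κ (fst hN) (snd hN) n c) := fun j hj =>
  dunkl_weightedSum_of_ne (fun e => by simp [← e, fst] at hj) (fun e => by simp [← e, snd] at hj)
    (fst_ne_snd hN) n c

theorem isPlanar_hPlus (hN : 2 ≤ N) (n : ℕ) : IsPlanar κ (hPlus hN κ n) := by
  obtain ⟨l, hl⟩ := exists_hPlus_eq_phiSum (κ := κ) hN n
  exact hl ▸ isPlanar_weightedSum hN n _

theorem isPlanar_hMinus (hN : 2 ≤ N) (n : ℕ) : IsPlanar κ (hMinus hN κ n) := by
  obtain ⟨l, hl⟩ := exists_hMinus_eq_psiSum (κ := κ) hN n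
  exact hl ▸ isPlanar_weightedSum hN n _

theorem isHomogeneous_hPlus (hN : 2 ≤ N) (n : ℕ) : (hPlus hN κ n).IsHomogeneous n := by
  obtain ⟨l, hl⟩ := exists_hPlus_eq_phiSum (κ := κ) hN n
  exact hl ▸ isHomogeneous_weightedSum _ _ n _

theorem isHomogeneous_hMinus (hN : 2 ≤ N) (n : ℕ) : (hMinus hN κ n).IsHomogeneous n := by
  obtain ⟨l, hl⟩ := exists_hMinus_eq_psiSum (κ := κ) hN n
  exact hl ▸ isHomogeneous_weightedSum _ _ n _

theorem rename_swap_hPlus (hN : 2 ≤ N) (n : ℕ) :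
    rename (Equiv.swap (fst hN) (snd hN)) (hPlus hN κ n) = hPlus hN κ n := by
  obtain ⟨l, hl⟩ := exists_hPlus_eq_phiSum (κ := κ) hN n
  rw [hl, rename_swap_phiSum]

theorem rename_swap_hMinus (hN : 2 ≤ N) (n : ℕ) :
    rename (Equiv.swap (fst hN) (snd hN)) (hMinus hN κ n) = -hMinus hN κ n := by
  obtain ⟨l, hl⟩ := exists_hMinus_eq_psiSum (κ := κ) hN n
  rw [hl, rename_swap_psiSum]

theorem hPlus_zero (hN : 2 ≤ N) : hPlus hN κ 0 = 1 := by
  have h : moment (evenSeq (pochRatio (fun j => (gOdd j).eval (N * κ - κ + (0 : ℕ)))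
      (N * κ + (0 : ℕ) + 1))) 1 = 1 := by
    rw [← Polynomial.monomial_zero_one, moment_monomial]
    simp [evenSeq, pochRatio, gOdd, poch_zero]
  rw [show hPlus hN κ 0 = hPlusEven hN κ 0 from hPlus_two_mul hN 0, hPlusEven_eq, phiSum,
    weightedSum]
  simp [pProd, pPoly_zero] at h ⊢
  rw [h, one_smul]

theorem hMinus_zero (hN : 2 ≤ N) : hMinus hN κ 0 = 0 := by
  simp [hMinus, hMinusEven]

/-- `T_1 + T_2` -/
def dunklPlus (hN : 2 ≤ N) (κ : ℝ) : MvPolynomial (Fin N) ℝ →ₗ[ℝ] MvPolynomial (Fin N) ℝ :=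
  dunklHom κ (fst hN) + dunklHom κ (snd hN)

/-- `T_1 - T_2` -/
def dunklMinus (hN : 2 ≤ N) (κ : ℝ) : MvPolynomial (Fin N) ℝ →ₗ[ℝ] MvPolynomial (Fin N) ℝ :=
  dunklHom κ (fst hN) - dunklHom κ (snd hN)

/-- The scalar by which `T_1 - T_2` lowers `h_{n+1}^-` to `h_n^+`. -/
def ladderB (N : ℕ) (κ : ℝ) (n : ℕ) : ℝ := 2 * (N * κ + ((n + 1) / 2 : ℕ) + 1)

/-- Minus the scalar by which `T_1 - T_2` lowers `h_{n+1}^+` to `h_n^-`. -/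
def ladderV (N : ℕ) (κ : ℝ) (n : ℕ) : ℝ := N * κ - κ + ((n + 1) / 2 : ℕ)

theorem neg_one_lt_mul (hN : 2 ≤ N) (hκ : -1 / (N : ℝ) < κ) : -1 < N * κ := by
  have : (0 : ℝ) < N := by exact_mod_cast (by omega : 0 < N)
  rw [div_lt_iff₀ this] at hκ
  linarith

theorem neg_one_lt_mul_sub (hN : 2 ≤ N) (hκ : -1 / (N : ℝ) < κ) : -1 < N * κ - κ := by
  have h := neg_one_lt_mul hN hκ
  have h2 : (2 : ℝ) ≤ N := by exact_mod_cast hN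
  rcases le_or_gt 0 κ with h0 | h0
  · nlinarith
  · linarith

theorem ladderB_pos (hN : 2 ≤ N) (hκ : -1 / (N : ℝ) < κ) (n : ℕ) : 0 < ladderB N κ n := by
  have h := neg_one_lt_mul hN hκ
  have h2 : (0 : ℝ) ≤ ((n + 1) / 2 : ℕ) := Nat.cast_nonneg _
  rw [ladderB]
  linarith

/-- At `n = 0` the scalar is `(N - 1)κ`, which need not be positive; there it multiplies only `h_0^-
= 0`. -/
theorem ladderV_pos (hN : 2 ≤ N) (hκ : -1 / (N : ℝ) < κ) {n : ℕ} (hn : n ≠ 0) :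
    0 < ladderV N κ n := by
  have h := neg_one_lt_mul_sub hN hκ
  have h2 : (1 : ℝ) ≤ ((n + 1) / 2 : ℕ) := by exact_mod_cast (by omega : 1 ≤ (n + 1) / 2)
  rw [ladderV]
  linarith

theorem ladderB_two_mul (m : ℕ) : ladderB N κ (2 * m) = 2 * (N * κ + m + 1) := by
  rw [ladderB, show (2 * m + 1) / 2 = m by omega]

theorem ladderB_two_mul_add_one (m : ℕ) : ladderB N κ (2 * m + 1) = 2 * (N * κ + m + 2) := by
  rw [ladderB, show (2 * m + 1 + 1) / 2 = m + 1 by omega]; push_cast; ring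

theorem ladderV_two_mul (m : ℕ) : ladderV N κ (2 * m) = N * κ - κ + m := by
  rw [ladderV, show (2 * m + 1) / 2 = m by omega]

theorem ladderV_two_mul_add_one (m : ℕ) : ladderV N κ (2 * m + 1) = N * κ - κ + m + 1 := by
  rw [ladderV, show (2 * m + 1 + 1) / 2 = m + 1 by omega]; push_cast; ring

theorem dunklPlus_hPlus (hN : 2 ≤ N) (hκ : -1 / (N : ℝ) < κ) (n : ℕ) :
    dunklPlus hN κ (hPlus hN κ (n + 1)) =
      (if Even n then ladderB N κ n else ladderV N κ n) • hPlus hN κ n := by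
  have h := neg_one_lt_mul hN hκ
  obtain ⟨m, rfl | rfl⟩ := Nat.even_or_odd' n
  · rw [if_pos (by simp), hPlus_two_mul_add_one, hPlus_two_mul, ladderB_two_mul]
    exact dunkl_add_hPlusOdd hN m (by linarith [(Nat.cast_nonneg m : (0 : ℝ) ≤ m)])
  · rw [if_neg (by simp), show 2 * m + 1 + 1 = 2 * (m + 1) by ring, hPlus_two_mul_add_one,
      hPlus_two_mul, ladderV_two_mul_add_one]
    exact dunkl_add_hPlusEven hN m (by linarith [(Nat.cast_nonneg m : (0 : ℝ) ≤ m)])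

theorem dunklMinus_hPlus (hN : 2 ≤ N) (hκ : -1 / (N : ℝ) < κ) (n : ℕ) :
    dunklMinus hN κ (hPlus hN κ (n + 1)) = (-ladderV N κ n) • hMinus hN κ n := by
  have h := neg_one_lt_mul hN hκ
  obtain ⟨m, rfl | rfl⟩ := Nat.even_or_odd' n
  · rw [hPlus_two_mul_add_one, hMinus_two_mul, ladderV_two_mul]
    exact dunkl_sub_hPlusOdd hN m (by linarith [(Nat.cast_nonneg m : (0 : ℝ) ≤ m)])
  · rw [show 2 * m + 1 + 1 = 2 * (m + 1) by ring, hMinus_two_mul_add_one,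
      hPlus_two_mul, ladderV_two_mul_add_one]
    exact dunkl_sub_hPlusEven hN m (by linarith [(Nat.cast_nonneg m : (0 : ℝ) ≤ m)])

theorem dunklMinus_hMinus (hN : 2 ≤ N) (hκ : -1 / (N : ℝ) < κ) (n : ℕ) :
    dunklMinus hN κ (hMinus hN κ (n + 1)) = ladderB N κ n • hPlus hN κ n := by
  have h := neg_one_lt_mul hN hκ
  obtain ⟨m, rfl | rfl⟩ := Nat.even_or_odd' n
  · rw [hMinus_two_mul_add_one, hPlus_two_mul, ladderB_two_mul]
    exact dunkl_sub_hMinusOdd hN m (by linarith [(Nat.cast_nonneg m : (0 : ℝ) ≤ m)])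
  · rw [show 2 * m + 1 + 1 = 2 * (m + 1) by ring, hPlus_two_mul_add_one,
      hMinus_two_mul, ladderB_two_mul_add_one]
    exact dunkl_sub_hMinusEven hN m (by linarith [(Nat.cast_nonneg m : (0 : ℝ) ≤ m)])

theorem dunklPlus_hMinus (hN : 2 ≤ N) (hκ : -1 / (N : ℝ) < κ) (n : ℕ) :
    dunklPlus hN κ (hMinus hN κ (n + 1)) =
      (if Even n then ladderV N κ n else ladderB N κ n) • hMinus hN κ n := by
  have h := neg_one_lt_mul hN hκ
  obtain ⟨m, rfl | rfl⟩ := Nat.even_or_odd' n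
  · rw [if_pos (by simp), hMinus_two_mul_add_one, hMinus_two_mul, ladderV_two_mul]
    exact dunkl_add_hMinusOdd hN m (by linarith [(Nat.cast_nonneg m : (0 : ℝ) ≤ m)])
  · rw [if_neg (by simp), show 2 * m + 1 + 1 = 2 * (m + 1) by ring, hMinus_two_mul_add_one,
      hMinus_two_mul, ladderB_two_mul_add_one]
    exact dunkl_add_hMinusEven hN m (by linarith [(Nat.cast_nonneg m : (0 : ℝ) ≤ m)])

theorem ladder_pos (hN : 2 ≤ N) (hκ : -1 / (N : ℝ) < κ) (n : ℕ) :
    0 < if Even n then ladderB N κ n else ladderV N κ n := by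
  split_ifs with h
  · exact ladderB_pos hN hκ n
  · exact ladderV_pos hN hκ fun e => h (by simp [e])

/-- Repeated use of `T_1 + T_2` descends to `h_0^+ = 1` through nonzero scalars. -/
theorem hPlus_ne_zero (hN : 2 ≤ N) (hκ : -1 / (N : ℝ) < κ) (n : ℕ) : hPlus hN κ n ≠ 0 := by
  induction n with
  | zero => rw [hPlus_zero]; exact one_ne_zero
  | succ n ih =>
    intro h
    have h2 := dunklPlus_hPlus hN hκ n
    rw [h, map_zero] at h2
    exact smul_ne_zero (ladder_pos hN hκ n).ne' ih h2.symm

theorem hMinus_ne_zero (hN : 2 ≤ N) (hκ : -1 / (N : ℝ) < κ) (n : ℕ) :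
    hMinus hN κ (n + 1) ≠ 0 := by
  intro h
  have h2 := dunklMinus_hMinus hN hκ n
  rw [h, map_zero] at h2
  exact smul_ne_zero (ladderB_pos hN hκ n).ne' (hPlus_ne_zero hN hκ n) h2.symm

theorem fst_or_snd_or_two_le (hN : 2 ≤ N) (j : Fin N) : j = fst hN ∨ j = snd hN ∨ 2 ≤ (j : ℕ) := by
  rw [Fin.ext_iff, Fin.ext_iff]
  simp only [fst, snd]
  omega

/-- Only `T_1²` and `T_2²` survive on a planar polynomial, and the cross terms of the two squares
cancel. -/
theorem two_smul_dunklLaplacian (hN : 2 ≤ N) {f : MvPolynomial (Fin N) ℝ} (hf : IsPlanar κ f) :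
    (2 : ℝ) • dunklLaplacian κ f =
      dunklPlus hN κ (dunklPlus hN κ f) + dunklMinus hN κ (dunklMinus hN κ f) := by
  have h : dunklLaplacian κ f = dunklHom κ (fst hN) (dunklHom κ (fst hN) f) +
      dunklHom κ (snd hN) (dunklHom κ (snd hN) f) := by
    rw [dunklLaplacian, Finset.sum_eq_add_of_mem (fst hN) (snd hN) (Finset.mem_univ _)
      (Finset.mem_univ _) (fst_ne_snd hN)]
    · rfl
    · rintro j - ⟨h1, h2⟩
      rw [hf j (by simpa [h1, h2] using fst_or_snd_or_two_le hN j), ← dunklHom_apply, map_zero]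
  rw [h, two_smul]
  simp only [dunklPlus, dunklMinus, LinearMap.add_apply, LinearMap.sub_apply, map_add, map_sub]
  abel

theorem dunklLaplacian_eq_zero_of_isHomogeneous_zero {f : MvPolynomial (Fin N) ℝ}
    (hf : f.IsHomogeneous 0) : dunklLaplacian κ f = 0 :=
  Finset.sum_eq_zero fun i _ => by
    rw [dunkl_eq_zero_of_isHomogeneous_zero hf, ← dunklHom_apply, map_zero]

theorem dunklLaplacian_eq_zero_of_isHomogeneous_one {f : MvPolynomial (Fin N) ℝ}
    (hf : f.IsHomogeneous 1) : dunklLaplacian κ f = 0 :=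
  Finset.sum_eq_zero fun _ _ => dunkl_eq_zero_of_isHomogeneous_zero (isHomogeneous_dunkl hf)

/-- For odd `n` the numbers `⌈n/2⌉` and `⌈(n+1)/2⌉` coincide, so neither scalar changes from `n` to
`n + 1`. -/
theorem ladder_mul_comm {n : ℕ} (hn : ¬ Even n) :
    ladderB N κ (n + 1) * ladderV N κ n = ladderV N κ (n + 1) * ladderB N κ n := by
  obtain ⟨m, rfl⟩ := Nat.not_even_iff_odd.1 hn
  rw [show 2 * m + 1 + 1 = 2 * (m + 1) by ring, ladderB_two_mul, ladderV_two_mul,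
    ladderB_two_mul_add_one, ladderV_two_mul_add_one]
  push_cast
  ring

theorem dunklLaplacian_hPlus (hN : 2 ≤ N) (hκ : -1 / (N : ℝ) < κ) (n : ℕ) :
    dunklLaplacian κ (hPlus hN κ n) = 0 := by
  match n with
  | 0 => exact dunklLaplacian_eq_zero_of_isHomogeneous_zero (isHomogeneous_hPlus hN 0)
  | 1 => exact dunklLaplacian_eq_zero_of_isHomogeneous_one (isHomogeneous_hPlus hN 1)
  | n + 2 =>
    have h := two_smul_dunklLaplacian hN (isPlanar_hPlus (κ := κ) hN (n + 2))
    rw [dunklPlus_hPlus hN hκ, dunklMinus_hPlus hN hκ, map_smul, map_smul, dunklPlus_hPlus hN hκ,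
      dunklMinus_hMinus hN hκ, smul_smul, smul_smul, ← add_smul] at h
    refine (smul_eq_zero.1 (h.trans ?_)).resolve_left two_ne_zero
    rw [smul_eq_zero]
    left
    by_cases hn : Even n
    · rw [if_neg (by simpa [Nat.even_add_one] using hn), if_pos hn]; ring
    · rw [if_pos (by simpa [Nat.even_add_one] using hn), if_neg hn]
      linear_combination ladder_mul_comm (N := N) (κ := κ) hn

theorem dunklLaplacian_hMinus (hN : 2 ≤ N) (hκ : -1 / (N : ℝ) < κ) (n : ℕ) :
    dunklLaplacian κ (hMinus hN κ n) = 0 := by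
  match n with
  | 0 => exact dunklLaplacian_eq_zero_of_isHomogeneous_zero (isHomogeneous_hMinus hN 0)
  | 1 => exact dunklLaplacian_eq_zero_of_isHomogeneous_one (isHomogeneous_hMinus hN 1)
  | n + 2 =>
    have h := two_smul_dunklLaplacian hN (isPlanar_hMinus (κ := κ) hN (n + 2))
    rw [dunklPlus_hMinus hN hκ, dunklMinus_hMinus hN hκ, map_smul, map_smul,
      dunklPlus_hMinus hN hκ, dunklMinus_hPlus hN hκ, smul_smul, smul_smul, ← add_smul] at h
    refine (smul_eq_zero.1 (h.trans ?_)).resolve_left two_ne_zero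
    rw [smul_eq_zero]
    left
    by_cases hn : Even n
    · rw [if_neg (by simpa [Nat.even_add_one] using hn), if_pos hn]; ring
    · rw [if_pos (by simpa [Nat.even_add_one] using hn), if_neg hn]
      linear_combination -ladder_mul_comm (N := N) (κ := κ) hn

/-- The Dunkl Laplacian as a linear map. -/
def laplacianHom (N : ℕ) (κ : ℝ) : MvPolynomial (Fin N) ℝ →ₗ[ℝ] MvPolynomial (Fin N) ℝ :=
  ∑ i, dunklHom κ i ∘ₗ dunklHom κ i

theorem laplacianHom_apply (f : MvPolynomial (Fin N) ℝ) :
    laplacianHom N κ f = dunklLaplacian κ f := by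
  simp [laplacianHom, dunklLaplacian, dunklHom_apply]

/-- The space of planar harmonic homogeneous polynomials of degree `n`. -/
def planarHarmonics (N : ℕ) (κ : ℝ) (n : ℕ) : Submodule ℝ (MvPolynomial (Fin N) ℝ) where
  carrier := {f | f.IsHomogeneous n ∧ IsPlanar κ f ∧ dunklLaplacian κ f = 0}
  zero_mem' := by
    refine ⟨isHomogeneous_zero _ _ _, fun j _ => ?_, ?_⟩
    · rw [← dunklHom_apply, map_zero]
    · rw [← laplacianHom_apply, map_zero]
  add_mem' := by
    rintro f g ⟨hf, hf', hf''⟩ ⟨hg, hg', hg''⟩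
    refine ⟨hf.add hg, fun j hj => ?_, ?_⟩
    · rw [← dunklHom_apply, map_add, dunklHom_apply, dunklHom_apply, hf' j hj, hg' j hj, add_zero]
    · rw [← laplacianHom_apply, map_add, laplacianHom_apply, laplacianHom_apply, hf'', hg'',
        add_zero]
  smul_mem' := by
    rintro c f ⟨hf, hf', hf''⟩
    refine ⟨by rw [smul_eq_C_mul]; exact hf.C_mul c, fun j hj => ?_, ?_⟩
    · rw [← dunklHom_apply, map_smul, dunklHom_apply, hf' j hj, smul_zero]
    · rw [← laplacianHom_apply, map_smul, laplacianHom_apply, hf'', smul_zero]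

theorem mem_planarHarmonics {n : ℕ} {f : MvPolynomial (Fin N) ℝ} :
    f ∈ planarHarmonics N κ n ↔ f.IsHomogeneous n ∧ IsPlanar κ f ∧ dunklLaplacian κ f = 0 :=
  Iff.rfl

theorem hPlus_mem (hN : 2 ≤ N) (hκ : -1 / (N : ℝ) < κ) (n : ℕ) :
    hPlus hN κ n ∈ planarHarmonics N κ n :=
  ⟨isHomogeneous_hPlus hN n, isPlanar_hPlus hN n, dunklLaplacian_hPlus hN hκ n⟩

theorem hMinus_mem (hN : 2 ≤ N) (hκ : -1 / (N : ℝ) < κ) (n : ℕ) :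
    hMinus hN κ n ∈ planarHarmonics N κ n :=
  ⟨isHomogeneous_hMinus hN n, isPlanar_hMinus hN n, dunklLaplacian_hMinus hN hκ n⟩

/-- `T_i` commutes with every `T_j`, hence with `Δ_κ`. -/
theorem dunklHom_mem_planarHarmonics (i : Fin N) {n : ℕ} {f : MvPolynomial (Fin N) ℝ}
    (hf : f ∈ planarHarmonics N κ (n + 1)) : dunklHom κ i f ∈ planarHarmonics N κ n := by
  obtain ⟨h1, h2, h3⟩ := hf
  refine ⟨isHomogeneous_dunkl h1, fun j hj => ?_, ?_⟩
  · rw [dunklHom_apply, dunkl_comm, h2 j hj, ← dunklHom_apply, map_zero]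
  · have : dunklLaplacian κ (dunklHom κ i f) = dunklHom κ i (dunklLaplacian κ f) := by
      rw [dunklLaplacian, dunklLaplacian, map_sum]
      refine Finset.sum_congr rfl fun j _ => ?_
      rw [dunklHom_apply, dunklHom_apply, dunkl_comm j i, dunkl_comm j i]
    rw [this, h3, map_zero]

theorem dunklPlus_mem (hN : 2 ≤ N) {n : ℕ} {f : MvPolynomial (Fin N) ℝ}
    (hf : f ∈ planarHarmonics N κ (n + 1)) : dunklPlus hN κ f ∈ planarHarmonics N κ n :=
  add_mem (dunklHom_mem_planarHarmonics _ hf) (dunklHom_mem_planarHarmonics _ hf)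

theorem dunklMinus_mem (hN : 2 ≤ N) {n : ℕ} {f : MvPolynomial (Fin N) ℝ}
    (hf : f ∈ planarHarmonics N κ (n + 1)) : dunklMinus hN κ f ∈ planarHarmonics N κ n :=
  sub_mem (dunklHom_mem_planarHarmonics _ hf) (dunklHom_mem_planarHarmonics _ hf)

theorem dunklMinus_dunklPlus (hN : 2 ≤ N) (f : MvPolynomial (Fin N) ℝ) :
    dunklMinus hN κ (dunklPlus hN κ f) = dunklPlus hN κ (dunklMinus hN κ f) := by
  have h : dunklHom κ (fst hN) (dunklHom κ (snd hN) f) =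
      dunklHom κ (snd hN) (dunklHom κ (fst hN) f) := dunkl_comm _ _ _
  simp only [dunklPlus, dunklMinus, LinearMap.add_apply, LinearMap.sub_apply, map_add, map_sub, h]
  abel

theorem rename_swap_dunklPlus (hN : 2 ≤ N) (f : MvPolynomial (Fin N) ℝ) :
    rename (Equiv.swap (fst hN) (snd hN)) (dunklPlus hN κ f) =
      dunklPlus hN κ (rename (Equiv.swap (fst hN) (snd hN)) f) := by
  simp only [dunklPlus, LinearMap.add_apply, dunklHom_apply, map_add, rename_dunkl,
    Equiv.swap_apply_left, Equiv.swap_apply_right]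
  abel

theorem rename_swap_dunklMinus (hN : 2 ≤ N) (f : MvPolynomial (Fin N) ℝ) :
    rename (Equiv.swap (fst hN) (snd hN)) (dunklMinus hN κ f) =
      -dunklMinus hN κ (rename (Equiv.swap (fst hN) (snd hN)) f) := by
  simp only [dunklMinus, LinearMap.sub_apply, dunklHom_apply, map_sub, rename_dunkl,
    Equiv.swap_apply_left, Equiv.swap_apply_right]
  abel

theorem rename_swap_mem (hN : 2 ≤ N) {n : ℕ} {f : MvPolynomial (Fin N) ℝ}
    (hf : f ∈ planarHarmonics N κ n) :
    rename (Equiv.swap (fst hN) (snd hN)) f ∈ planarHarmonics N κ n := by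
  obtain ⟨h1, h2, h3⟩ := hf
  refine ⟨h1.rename_isHomogeneous, fun j hj => ?_, ?_⟩
  · have e : Equiv.swap (fst hN) (snd hN) j = j :=
      Equiv.swap_apply_of_ne_of_ne (fun e => by simp [e, fst] at hj)
        (fun e => by simp [e, snd] at hj)
    have := rename_dunkl (κ := κ) (Equiv.swap (fst hN) (snd hN)) j f
    rw [e, h2 j hj, map_zero] at this
    exact this.symm
  · have := congrArg (rename (Equiv.swap (fst hN) (snd hN))) h3
    rw [dunklLaplacian, map_sum, map_zero] at this
    simp only [rename_dunkl] at this
    rw [← this, dunklLaplacian]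
    exact (Equiv.sum_comp (Equiv.swap (fst hN) (snd hN)) fun i =>
      dunkl κ i (dunkl κ i (rename (Equiv.swap (fst hN) (snd hN)) f))).symm

theorem eq_zero_of_dunklPlus_dunklMinus (hN : 2 ≤ N) (hκ : -1 / (N : ℝ) < κ) {n : ℕ}
    {f : MvPolynomial (Fin N) ℝ} (hf : f ∈ planarHarmonics N κ (n + 1))
    (hp : dunklPlus hN κ f = 0) (hm : dunklMinus hN κ f = 0) : f = 0 := by
  rw [dunklPlus, LinearMap.add_apply, dunklHom_apply, dunklHom_apply] at hp
  rw [dunklMinus, LinearMap.sub_apply, dunklHom_apply, dunklHom_apply, sub_eq_zero] at hm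
  have h2 : dunkl κ (snd hN) f = 0 := by
    rw [hm, ← two_smul ℝ] at hp
    exact (smul_eq_zero.1 hp).resolve_left two_ne_zero
  refine eq_zero_of_forall_dunkl_eq_zero hκ n.succ_ne_zero hf.1 fun i => ?_
  rcases fst_or_snd_or_two_le hN i with rfl | rfl | hi
  · rw [hm, h2]
  · exact h2
  · exact hf.2.1 i hi

/-- Both parities are proved together, since `T_1 - T_2` exchanges them. The ladder removes a
multiple of `h_{n+1}^±` so that the remainder is killed by `T_1 + T_2` in the symmetric case and by
`T_1 - T_2` in the antisymmetric case; `kill` then disposes of the other operator. -/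
theorem exists_eq_smul (hN : 2 ≤ N) (hκ : -1 / (N : ℝ) < κ) (n : ℕ)
    {f : MvPolynomial (Fin N) ℝ} (hf : f ∈ planarHarmonics N κ n) :
    (rename (Equiv.swap (fst hN) (snd hN)) f = f → ∃ c : ℝ, f = c • hPlus hN κ n) ∧
      (rename (Equiv.swap (fst hN) (snd hN)) f = -f → ∃ c : ℝ, f = c • hMinus hN κ n) := by
  induction n generalizing f with
  | zero =>
    obtain ⟨c, rfl⟩ : ∃ c, f = C c :=
      ⟨_, totalDegree_eq_zero_iff_eq_C.1 ((totalDegree_zero_iff_isHomogeneous _).2 hf.1)⟩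
    refine ⟨fun _ => ⟨c, by rw [hPlus_zero, smul_eq_C_mul, mul_one]⟩, fun h => ⟨0, ?_⟩⟩
    rw [rename_C] at h
    rw [zero_smul, self_eq_neg.1 h]
  | succ n ih =>
    -- `T_1 - T_2` is injective on multiples of `h_n^-`: either `h_0^- = 0`, or it lowers to a
    -- nonzero multiple of `h_{n-1}^+`.
    have kill : ∀ β : ℝ, dunklMinus hN κ (β • hMinus hN κ n) = 0 → β • hMinus hN κ n = 0 := by
      intro β h
      cases n with
      | zero => rw [hMinus_zero, smul_zero]
      | succ k =>
        rw [map_smul, dunklMinus_hMinus hN hκ, smul_smul] at h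
        have := (smul_eq_zero.1 h).resolve_right (hPlus_ne_zero hN hκ k)
        rw [(mul_eq_zero.1 this).resolve_right (ladderB_pos hN hκ k).ne', zero_smul]
    constructor
    · intro hs
      obtain ⟨α, hα⟩ := (ih (dunklPlus_mem hN hf)).1 (by rw [rename_swap_dunklPlus, hs])
      set a := if Even n then ladderB N κ n else ladderV N κ n with ha
      have ha0 : a ≠ 0 := (ladder_pos hN hκ n).ne'
      set g := f - (α / a) • hPlus hN κ (n + 1) with hg
      have hgm : g ∈ planarHarmonics N κ (n + 1) :=
        sub_mem hf (Submodule.smul_mem _ _ (hPlus_mem hN hκ _))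
      have hp : dunklPlus hN κ g = 0 := by
        rw [hg, map_sub, map_smul, dunklPlus_hPlus hN hκ, hα, smul_smul, ← ha,
          div_mul_cancel₀ _ ha0, sub_self]
      have hgs : rename (Equiv.swap (fst hN) (snd hN)) g = g := by
        rw [hg, map_sub, map_smul, rename_swap_hPlus, hs]
      obtain ⟨β, hβ⟩ := (ih (dunklMinus_mem hN hgm)).2 (by rw [rename_swap_dunklMinus, hgs])
      have hm : dunklMinus hN κ g = 0 := by
        rw [hβ]
        refine kill β ?_
        -- As `T_1 + T_2` kills `g`, harmonicity reduces to `(T_1 - T_2)² g = 0`.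
        have := two_smul_dunklLaplacian hN hgm.2.1
        rw [hgm.2.2, smul_zero, hp, map_zero, zero_add, hβ] at this
        exact this.symm
      exact ⟨α / a, sub_eq_zero.1 (eq_zero_of_dunklPlus_dunklMinus hN hκ hgm hp hm)⟩
    · intro hs
      obtain ⟨α, hα⟩ := (ih (dunklMinus_mem hN hf)).1 (by
        rw [rename_swap_dunklMinus, hs, map_neg, neg_neg])
      have hb0 := (ladderB_pos hN hκ n).ne'
      set g := f - (α / ladderB N κ n) • hMinus hN κ (n + 1) with hg
      have hgm : g ∈ planarHarmonics N κ (n + 1) :=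
        sub_mem hf (Submodule.smul_mem _ _ (hMinus_mem hN hκ _))
      have hm : dunklMinus hN κ g = 0 := by
        rw [hg, map_sub, map_smul, dunklMinus_hMinus hN hκ, hα, smul_smul,
          div_mul_cancel₀ _ hb0, sub_self]
      have hgs : rename (Equiv.swap (fst hN) (snd hN)) g = -g := by
        rw [hg, map_sub, map_smul, rename_swap_hMinus, hs, smul_neg]
        abel
      obtain ⟨β, hβ⟩ := (ih (dunklPlus_mem hN hgm)).2 (by
        rw [rename_swap_dunklPlus, hgs, map_neg])
      have hp : dunklPlus hN κ g = 0 := by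
        rw [hβ]
        refine kill β ?_
        -- Here commutativity replaces harmonicity: `(T_1 - T_2)(T_1 + T_2) g = (T_1 + T_2)(T_1 -
        -- T_2) g = 0`.
        rw [← hβ, dunklMinus_dunklPlus, hm, map_zero]
      exact ⟨_, sub_eq_zero.1 (eq_zero_of_dunklPlus_dunklMinus hN hκ hgm hp hm)⟩

theorem planarHarmonics_eq_span (hN : 2 ≤ N) (hκ : -1 / (N : ℝ) < κ) (n : ℕ) :
    planarHarmonics N κ n = Submodule.span ℝ {hPlus hN κ n, hMinus hN κ n} := by
  apply le_antisymm
  · intro f hf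
    have hf' := rename_swap_mem hN hf
    set f' := rename (Equiv.swap (fst hN) (snd hN)) f with hdef
    have hff : rename (Equiv.swap (fst hN) (snd hN)) f' = f := rename_swap_swap _ _ _
    obtain ⟨a, ha⟩ := (exists_eq_smul hN hκ n (add_mem hf hf')).1 (by
      rw [map_add, hff, ← hdef, add_comm])
    obtain ⟨b, hb⟩ := (exists_eq_smul hN hκ n (sub_mem hf hf')).2 (by
      rw [map_sub, hff, ← hdef, neg_sub])
    rw [Submodule.mem_span_pair]
    refine ⟨a / 2, b / 2, ?_⟩
    rw [div_eq_inv_mul, div_eq_inv_mul, mul_smul, mul_smul, ← ha, ← hb, ← smul_add,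
      add_add_sub_cancel, ← two_smul ℝ, smul_smul, inv_mul_cancel₀ two_ne_zero, one_smul]
  · rw [Submodule.span_le]
    rintro f (rfl | rfl)
    · exact hPlus_mem hN hκ n
    · exact hMinus_mem hN hκ n

/-- Applying the transposition to a linear relation separates two nonzero vectors of opposite
parity. -/
theorem linearIndependent_hPlus_hMinus (hN : 2 ≤ N) (hκ : -1 / (N : ℝ) < κ) {n : ℕ}
    (hn : 1 ≤ n) : LinearIndependent ℝ ![hPlus hN κ n, hMinus hN κ n] := by
  rw [LinearIndependent.pair_iff]
  intro s t h
  have h2 := congrArg (rename (Equiv.swap (fst hN) (snd hN))) h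
  rw [map_add, map_smul, map_smul, rename_swap_hPlus, rename_swap_hMinus, map_zero, smul_neg] at h2
  obtain ⟨k, rfl⟩ := Nat.exists_eq_succ_of_ne_zero (by omega : n ≠ 0)
  have hs : (2 * s) • hPlus hN κ (k + 1) = 0 := by
    rw [mul_smul, two_smul]
    linear_combination h + h2
  have ht : (2 * t) • hMinus hN κ (k + 1) = 0 := by
    rw [mul_smul, two_smul]
    linear_combination h - h2
  have hs' := (smul_eq_zero.1 hs).resolve_right (hPlus_ne_zero hN hκ _)
  have ht' := (smul_eq_zero.1 ht).resolve_right (hMinus_ne_zero hN hκ _)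
  constructor <;> linarith

end Main

end PlanarHarmonic

end

theorem mainTheorem1 {N : ℕ} (hN : 2 ≤ N) (κ : ℝ) (hκ : -1 / (N : ℝ) < κ) (n : ℕ) :
    -- both polynomials are harmonic
    PlanarHarmonic.dunklLaplacian κ (PlanarHarmonic.hPlus hN κ n) = 0 ∧
    PlanarHarmonic.dunklLaplacian κ (PlanarHarmonic.hMinus hN κ n) = 0 ∧
    -- `h_n^+` is symmetric and `h_n^-` is antisymmetric under the transposition `(1,2)`
    MvPolynomial.rename (Equiv.swap (PlanarHarmonic.fst hN) (PlanarHarmonic.snd hN))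
      (PlanarHarmonic.hPlus hN κ n) = PlanarHarmonic.hPlus hN κ n ∧
    MvPolynomial.rename (Equiv.swap (PlanarHarmonic.fst hN) (PlanarHarmonic.snd hN))
      (PlanarHarmonic.hMinus hN κ n) = -PlanarHarmonic.hMinus hN κ n ∧
    -- the planar harmonic homogeneous polynomials of degree `n` are exactly their span
    (∀ f : MvPolynomial (Fin N) ℝ,
      (f.IsHomogeneous n ∧ PlanarHarmonic.IsPlanar κ f ∧ PlanarHarmonic.dunklLaplacian κ f = 0) ↔
        f ∈ Submodule.span ℝ {PlanarHarmonic.hPlus hN κ n, PlanarHarmonic.hMinus hN κ n}) ∧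
    -- and the two are independent in every degree `n ≥ 1`
    (1 ≤ n → LinearIndependent ℝ ![PlanarHarmonic.hPlus hN κ n, PlanarHarmonic.hMinus hN κ n]) := by
  refine ⟨PlanarHarmonic.dunklLaplacian_hPlus hN hκ n, PlanarHarmonic.dunklLaplacian_hMinus hN hκ n,
    PlanarHarmonic.rename_swap_hPlus hN n, PlanarHarmonic.rename_swap_hMinus hN n, fun f => ?_,
    PlanarHarmonic.linearIndependent_hPlus_hMinus hN hκ⟩
  rw [← PlanarHarmonic.planarHarmonics_eq_span hN hκ n]
  exact PlanarHarmonic.mem_planarHarmonics.symm
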